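/- **Setting.** Let $d\ge 2$, $n\ge 1$, $p\in(0,1)$, $q>1$, and let $E$ be the edge set of the torus $\Lambda=(\mathbb Z/n\mathbb Z)^d$ (as a simple graph). A configuration is a subset of $E$ (its open edges); $c(S)$ is the number of connected components of $(\Lambda,S)$, and $e$ is a cut-edge in $S$ if $c(S\setminus\{e\})\ne c(S\cup\{e\})$. Put $p^*=\frac{p}{q(1-p)+p}$ and $\tau_s=s\,p^{-1/2}$. Attach to the edges independent rate one Poisson processes, whose points $t$ carry independent marks $U$ uniform on $[0,1]$, and let $\mathrm{Upd}(e)$ be the set of the pairs $(t,U)$ at $e$ (the updates of $e$); for $s<t$ let $\mathrm{Upd}[s,t](e)$ be the set of the updates of $e$ with time in $(s,t]$. The FK-dynamics $(X_t)_{t\ge0}$ with initial configuration $X_0$ (deterministic, or random and independent of the updates) changes only at update times: at $(t,U)\in \mathrm{Upd}(e)$ the edge $e$ becomes closed if $U<1-p$, open if $1-p\le U<1-p+p^*$, and, if $U\ge 1-p+p^*$, closed if $e$ is a cut-edge in $X_{t-}$ and open otherwise. An update with $U<1-p+p^*$ is called oblivious. For $i\ge0$ let $\Xi_i\subset E$ be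 the set of the edges $e$ which either have no update in $(\tau_i,\tau_{i+1}]$, or are open at some time of $[\tau_i,\tau_{i+1}]$ in the percolation dynamics started empty at $\tau_i$ (in which an edge is open at time $t$ iff it has an update in $(\tau_i,t]$ and the last one has $U>1-p$). For $\Xi\subset E$ and $e\in\Xi$ let $\overline{\mathrm{Conn}}(e;\Xi)$ consist of the edges of the connected component of $\Xi$ containing $e$ and of all the edges sharing a vertex with one of them; for $e\notin\Xi$ it is empty. Fix $m\ge2$. The history $\mathscr H_e$ of $e\in E$ is defined backward in time from $\mathscr H_e(\tau_m)=\{e\}$: given $\mathscr H_e(\tau_{i+1})$ with $1\le i\le m-1$, let $C$ be the union of the sets $\overline{\mathrm{Conn}}(w;\Xi_{i-1}\cup\Xi_i)$ over those $w\in\mathscr H_e(\tau_{i+1})$ which are updated in $(\tau_i,\tau_{i+1}]$ and whose last update there is not oblivious, and set $$\mathscr H_e(\tau_{i+1/2})=\mathscr H_e(\tau_{i+1})\cup C,\qquad \mathscr H_e(\tau_i)=C\cup\{w\in\mathscr H_e(\tau_{i+1}):\mathrm{Upd}[\tau_i,\tau_{i+1}](w)=\emptyset\}.$$ Put $\mathscr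 H_A=\bigcup_{e\in A}\mathscr H_e$ for $A\subset E$. The family $\mathscr H=(\mathscr H_e)_{e\in E}$ is the history diagram. Join $e$ and $e'$ if $\mathscr H_e(\tau_s)\cap\mathscr H_{e'}(\tau_s)\neq\emptyset$ for some $s\in\{1,\tfrac32,2,\dots,m\}$; the connected components of the resulting graph on $E$ are the information-percolation clusters of $\mathscr H$. **Theorem 4.5.** Fix a history diagram $\mathscr H$ and a cluster $A\subset E$ of $\mathscr H$, and let $1\le i\le m-1$. Then, almost surely on the event that the history diagram is $\mathscr H$, the configuration $X_{\tau_{i+1}}$ restricted to $\mathscr H_A(\tau_{i+1})$ is a deterministic function (the same for all initial configurations) of $$X_{\tau_i}\text{ restricted to }\mathscr H_A(\tau_i)\qquad\text{and}\qquad \bigcup_{e\in \mathscr H_A(\tau_{i+1/2})}\mathrm{Upd}[\tau_i,\tau_{i+1}](e).$$ In particular, if $\mathscr H_A(\tau_i)=\emptyset$, then, conditionally on the history diagram being $\mathscr H$, the configuration $X_{\tau_{i+1}}$ restricted to $\mathscr H_A(\tau_{i+1})$ is independent of $(X_s)_{0\le s\le\tau_i}$, hence of $X_{\tau_i}$ and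 of $X_{\tau_1}$. -/

import Mathlib

open MeasureTheory ProbabilityTheory

noncomputable section

namespace FK

/-- The discrete torus `(ℤ/nℤ)^d`: `x` and `y` are neighbours when they differ by `±1` in exactly
one coordinate.  The graph is simple (no loops, no parallel edges when `n ≤ 2`). -/
def torus (d n : ℕ) : SimpleGraph (Fin d → ZMod n) :=
  SimpleGraph.fromRel fun x y => ∃ k : Fin d, y = x + Pi.single k 1

/-! ### Configurations

An edge configuration is a set of edges, the set of its open edges. -/

section Configurations

variable {V : Type*} {G : SimpleGraph V}

/-- The graph with all the vertices of `G` whose edges are the open edges of `S`. -/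
def openGraph (S : Set G.edgeSet) : SimpleGraph V :=
  SimpleGraph.fromEdgeSet (Subtype.val '' S)

/-- The number `c(S)` of connected components of the open graph (isolated vertices count). -/
def numComponents (S : Set G.edgeSet) : ℕ :=
  Nat.card (openGraph S).ConnectedComponent

/-- `e` is a cut-edge in `S` if `c(S ∖ {e}) ≠ c(S ∪ {e})`. -/
def IsCutEdge (S : Set G.edgeSet) (e : G.edgeSet) : Prop :=
  numComponents (S \ {e}) ≠ numComponents (S ∪ {e})

/-- Two edges are adjacent if they have a common endpoint. -/
def EdgeAdj (e f : G.edgeSet) : Prop :=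
  ∃ x : V, x ∈ (e : Sym2 V) ∧ x ∈ (f : Sym2 V)

/-- The set of the edges of the open connected component of `S` that contains `e`;
it is empty if `e` is closed in `S`. -/
def conn (e : G.edgeSet) (S : Set G.edgeSet) : Set G.edgeSet :=
  {f | e ∈ S ∧ f ∈ S ∧
    ∃ x ∈ (e : Sym2 V), ∃ y ∈ (f : Sym2 V), (openGraph S).Reachable x y}

/-- The edge boundary: the edges outside `C` that are adjacent to an edge of `C`. -/
def edgeBoundary (C : Set G.edgeSet) : Set G.edgeSet :=
  {f | f ∉ C ∧ ∃ g ∈ C, EdgeAdj f g}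

/-- The component of `e` together with its edge boundary (empty if `e` is closed in `S`). -/
def connBar (e : G.edgeSet) (S : Set G.edgeSet) : Set G.edgeSet :=
  conn e S ∪ edgeBoundary (conn e S)

end Configurations

/-! ### Realizations of the update sequence and the objects they determine

A realization of the update sequence attaches to every edge `e` the set `Upd(e)` of its updates
`(t, U)`. -/

/-- `p* = p / (q(1-p) + p)`. -/
def pStar (p q : ℝ) : ℝ := p / (q * (1 - p) + p)

/-- `τ_i = i Δ` with `Δ = p^{-1/2}`. -/
def tau (p : ℝ) (i : ℕ) : ℝ := i * (Real.sqrt p)⁻¹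

section Realizations

variable {E : Type*}

/-- `Upd[s,t](e)`: the updates of `e` in the time interval `(s, t]`. -/
def updIn (upd : E → Set (ℝ × ℝ)) (s t : ℝ) (e : E) : Set (ℝ × ℝ) :=
  {a | a ∈ upd e ∧ s < a.1 ∧ a.1 ≤ t}

/-- `⋃_{e ∈ B} Upd[s,t](e)`, where every update remembers the edge it is attached to. -/
def updOn (upd : E → Set (ℝ × ℝ)) (s t : ℝ) (B : Set E) : Set (E × ℝ × ℝ) :=
  {a | a.1 ∈ B ∧ a.2 ∈ updIn upd s t a.1}

/-- `a` is the last update of `e` in `(s, t]`. -/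
def IsLastUpd (upd : E → Set (ℝ × ℝ)) (s t : ℝ) (e : E) (a : ℝ × ℝ) : Prop :=
  a ∈ updIn upd s t e ∧ ∀ b ∈ updIn upd s t e, b.1 ≤ a.1

/-- The standard percolation dynamics at time `t`, started from the empty configuration at time
`τ_i`: an edge is open iff it has an update in `(τ_i, t]` and the last one has `U > 1 - p`. -/
def emptySPD (p : ℝ) (upd : E → Set (ℝ × ℝ)) (i : ℕ) (t : ℝ) : Set E :=
  {e | ∃ a, IsLastUpd upd (tau p i) t e a ∧ 1 - p < a.2}

/-- The edges that are open in the dynamics started empty at `τ_i` for some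
`t ∈ [τ_i, τ_{i+1}]`. -/
def enlargedEmpty (p : ℝ) (upd : E → Set (ℝ × ℝ)) (i : ℕ) : Set E :=
  {e | ∃ t ∈ Set.Icc (tau p i) (tau p (i + 1)), e ∈ emptySPD p upd i t}

/-- The edges without an update in `(τ_i, τ_{i+1}]`. -/
def nonUpdate (p : ℝ) (upd : E → Set (ℝ × ℝ)) (i : ℕ) : Set E :=
  {e | updIn upd (tau p i) (tau p (i + 1)) e = ∅}

/-- `Ξ_i`, the union of the two preceding percolations. -/
def env (p : ℝ) (upd : E → Set (ℝ × ℝ)) (i : ℕ) : Set E :=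
  enlargedEmpty p upd i ∪ nonUpdate p upd i

/-- The edges that are updated in `(τ_i, τ_{i+1}]` and whose last update `(t, U)` in this interval
is not oblivious, that is, does not satisfy `U < 1 - p + p*`. -/
def nonOblivious (p q : ℝ) (upd : E → Set (ℝ × ℝ)) (i : ℕ) : Set E :=
  {e | ∃ a, IsLastUpd upd (tau p i) (tau p (i + 1)) e a ∧ ¬ a.2 < 1 - p + pStar p q}

end Realizations

/-! ### The FK-dynamics -/

section Dynamics

variable {V : Type*} {G : SimpleGraph V}

/-- The effect on the configuration `S` of the updates `(t, U)` at the time `t`: an edge `e` with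
such an update becomes closed if `U < 1 - p`, open if `1 - p ≤ U < 1 - p + p*`, and otherwise open
iff it is not a cut-edge in `S`; the other edges keep their state. -/
def applyUpdates (p q : ℝ) (upd : G.edgeSet → Set (ℝ × ℝ)) (S : Set G.edgeSet) (t : ℝ) :
    Set G.edgeSet :=
  {e | (∃ U, (t, U) ∈ upd e ∧ 1 - p ≤ U ∧ (U < 1 - p + pStar p q ∨ ¬ IsCutEdge S e)) ∨
    ((∀ U, (t, U) ∉ upd e) ∧ e ∈ S)}

/-- The times in `(0, t]` at which some edge is updated. -/
def updateTimes (upd : G.edgeSet → Set (ℝ × ℝ)) (t : ℝ) : Set ℝ :=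
  {s | 0 < s ∧ s ≤ t ∧ ∃ e U, (s, U) ∈ upd e}

open Classical in
/-- The FK-dynamics `X_t` driven by a realization of the update sequence and started from `x₀`:
the updates in `(0, t]` are applied one after the other in chronological order.  (There are almost
surely finitely many of them, at distinct times; the value `x₀` in the other case is a dummy.) -/
def fkState (p q : ℝ) (upd : G.edgeSet → Set (ℝ × ℝ)) (x₀ : Set G.edgeSet) (t : ℝ) :
    Set G.edgeSet :=
  if h : (updateTimes upd t).Finite then
    (h.toFinset.sort (· ≤ ·)).foldl (applyUpdates p q upd) x₀
  else x₀

end Dynamics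

/-! ### History diagrams and information percolation clusters -/

/-- A history diagram: `at_ e i` is the set `𝓗_e(τ_i)` and `mid e i` is the set
`𝓗_e(τ_{i+1/2})`.  A time edge joins `(w, τ_i)` to the level above (if any) and to the level below
(if any) exactly when `w ∈ 𝓗_e(τ_i)`, so the time edges need not be recorded separately. -/
@[ext] structure HistoryDiagram (E : Type*) where
  at_ : E → ℕ → Set E
  mid : E → ℕ → Set E

namespace HistoryDiagram

variable {E : Type*}

/-- `𝓗_A(τ_i) = ⋃_{e ∈ A} 𝓗_e(τ_i)`. -/
def atSet (H : HistoryDiagram E) (A : Set E) (i : ℕ) : Set E := ⋃ e ∈ A, H.at_ e i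

/-- `𝓗_A(τ_{i+1/2}) = ⋃_{e ∈ A} 𝓗_e(τ_{i+1/2})`. -/
def midSet (H : HistoryDiagram E) (A : Set E) (i : ℕ) : Set E := ⋃ e ∈ A, H.mid e i

/-- The graph on the set of edges in which `e` and `e'` are joined when their histories share an
edge (at the same level). -/
def clusterGraph (H : HistoryDiagram E) : SimpleGraph E :=
  SimpleGraph.fromRel fun e e' =>
    ∃ i, (H.at_ e i ∩ H.at_ e' i).Nonempty ∨ (H.mid e i ∩ H.mid e' i).Nonempty

/-- `A` is an information percolation cluster: a connected component of the cluster graph. -/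
def IsCluster (H : HistoryDiagram E) (A : Set E) : Prop :=
  ∃ C : H.clusterGraph.ConnectedComponent, A = C.supp

end HistoryDiagram

section History

variable {V : Type*} {G : SimpleGraph V}

/-- The edges to which the edges of `W = 𝓗(τ_{i+1})` with a non-oblivious last update spread in
`[τ_i, τ_{i+1}]`, for `i ≥ 1`. -/
def spread (p q : ℝ) (upd : G.edgeSet → Set (ℝ × ℝ)) (i : ℕ) (W : Set G.edgeSet) :
    Set G.edgeSet :=
  ⋃ w ∈ W ∩ nonOblivious p q upd i, connBar w (env p upd (i - 1) ∪ env p upd i)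

/-- One step back in time, from `W = 𝓗(τ_{i+1})` to `𝓗(τ_i)`, for `i ≥ 1`: the edges without an
update stay, those with an oblivious last update disappear, the others spread. -/
def stepBack (p q : ℝ) (upd : G.edgeSet → Set (ℝ × ℝ)) (i : ℕ) (W : Set G.edgeSet) :
    Set G.edgeSet :=
  (W ∩ nonUpdate p upd i) ∪ spread p q upd i W

/-- The history of `e` after `k` steps back from `τ_m`, that is, `𝓗_e(τ_{m-k})`, for `k < m`. -/
def historyBack (p q : ℝ) (upd : G.edgeSet → Set (ℝ × ℝ)) (m : ℕ) (e : G.edgeSet) :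
    ℕ → Set G.edgeSet
  | 0 => {e}
  | k + 1 => stepBack p q upd (m - (k + 1)) (historyBack p q upd m e k)

/-- The history diagram on the slab `[τ_1, τ_m]`.  The levels are `τ_i` for `1 ≤ i ≤ m` and
`τ_{i+1/2}` for `1 ≤ i ≤ m - 1`; the sets are empty outside this range. -/
def historyDiagram (p q : ℝ) (upd : G.edgeSet → Set (ℝ × ℝ)) (m : ℕ) :
    HistoryDiagram G.edgeSet where
  at_ e i := {w | 1 ≤ i ∧ i ≤ m ∧ w ∈ historyBack p q upd m e (m - i)}
  mid e i := {w | 1 ≤ i ∧ i + 1 ≤ m ∧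
    w ∈ historyBack p q upd m e (m - (i + 1)) ∪
      spread p q upd i (historyBack p q upd m e (m - (i + 1)))}

end History

/-! ### The random update sequence -/

/-- The random update sequence on the edge set `E`: independent rate one Poisson processes attached
to the edges (given by their independent exponential waiting times `gap e k`), whose points carry
independent marks `mark e k`, uniform in `[0, 1]`. -/
structure RandomUpdates (E : Type*) {Ω : Type*} [MeasurableSpace Ω] (μ : Measure Ω) where
  gap : E → ℕ → Ω → ℝ
  mark : E → ℕ → Ω → ℝ
  measurable_gap : ∀ e k, Measurable (gap e k)
  measurable_mark : ∀ e k, Measurable (mark e k)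
  law_gap : ∀ e k, μ.map (gap e k) = expMeasure 1
  law_mark : ∀ e k, μ.map (mark e k) = volume.restrict (Set.Icc (0 : ℝ) 1)
  indep : iIndepFun
    (fun z : (E × ℕ) ⊕ (E × ℕ) => Sum.elim (fun a => gap a.1 a.2) (fun a => mark a.1 a.2) z) μ

namespace RandomUpdates

variable {E Ω : Type*} [MeasurableSpace Ω] {μ : Measure Ω}

/-- The time of the `k`-th update of `e` (`k = 0, 1, …`). -/
def time (R : RandomUpdates E μ) (e : E) (k : ℕ) (ω : Ω) : ℝ :=
  ∑ j ∈ Finset.range (k + 1), R.gap e j ω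

/-- The realization `ω` of the update sequence, `Upd(e) = {(t_k, U_k)}`. -/
def upd (R : RandomUpdates E μ) (ω : Ω) (e : E) : Set (ℝ × ℝ) :=
  {a | ∃ k, a = (R.time e k ω, R.mark e k ω)}

/-- The random variable `X` is independent of the whole update sequence. -/
def IndepOf (R : RandomUpdates E μ) {α : Type*} [MeasurableSpace α] (X : Ω → α) : Prop :=
  IndepFun X (fun ω (z : E × ℕ) => (R.gap z.1 z.2 ω, R.mark z.1 z.2 ω)) μ

end RandomUpdates

end FK

end

namespace FK

/-! ### Cut-edges -/

section CutEdges

variable {V : Type*} {G : SimpleGraph V}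

/-! Deterministic part. During the slab (τ_i, τ_{i+1}] the configuration stays inside Ξ = Ξ_{i-1} ∪
Ξ_i: an edge open at τ_i was opened in the preceding slab or not updated there, and an edge opened
later belongs to Ξ_i. Whether an edge of Ξ is a cut-edge depends only on the open edges in its
component of Ξ (`isCutEdge_congr`), so each component of Ξ evolves autonomously
(`evolve_inter_conn`). Hence the state of w at τ_{i+1} is its state at τ_i if w is not updated, is
given by the mark if its last update is oblivious, and otherwise comes from running the dynamics in
the component of w in Ξ. The history records exactly the edges needed in each case
(`Regular.fkState_inter_eq`).

Independence. To find a component one has to inspect the environment on it and on its boundary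
(`connBar_congr`). As histories include these boundaries, they are determined by the updates in the
space-time region they cover (`historyDiagram_congr`), and a cluster and its complement have
disjoint regions. If 𝓗_A(τ_i) = ∅, the region of A lies in the slabs from i on. Up to null sets, the
event that the diagram is 𝓗 is then the intersection of an event determined by the updates in this
region and one determined by the other updates. On it, the configuration on 𝓗_A(τ_{i+1}) is a
function of the former updates, and the past up to τ_i is a function of X_0 and the latter.
Conditioning on a product event preserves independence (`indepFun_cond_of_indepFun`).

Probabilistic input. The updates of distinct edges in distinct slabs are independent
(`RandomUpdates.iIndepFun_slabs`). Since the Poisson processes are given by exponential waiting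
times, this rests on the Markov property at a fixed time (`pathLaw_markov`), obtained from
memorylessness by induction on the number of points. -/

lemma openGraph_adj {S : Set G.edgeSet} {x y : V} :
    (openGraph S).Adj x y ↔ ∃ f ∈ S, (f : Sym2 V) = s(x, y) := by
  simp only [openGraph, SimpleGraph.fromEdgeSet_adj, Set.mem_image]
  constructor
  · rintro ⟨⟨f, hf, h⟩, -⟩
    exact ⟨f, hf, h⟩
  · rintro ⟨f, hf, h⟩
    refine ⟨⟨f, hf, h⟩, ?_⟩
    have := f.2
    rw [h, SimpleGraph.mem_edgeSet] at this
    exact this.ne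

lemma openGraph_mono {S T : Set G.edgeSet} (h : S ⊆ T) : openGraph S ≤ openGraph T :=
  SimpleGraph.fromEdgeSet_mono (Set.image_mono h)

lemma reachable_of_mem {S : Set G.edgeSet} {f : G.edgeSet} (hf : f ∈ S) {x y : V}
    (hx : x ∈ (f : Sym2 V)) (hy : y ∈ (f : Sym2 V)) : (openGraph S).Reachable x y := by
  rcases eq_or_ne x y with rfl | hxy
  · exact SimpleGraph.Reachable.refl _
  · exact (openGraph_adj.2 ⟨f, hf, (Sym2.mem_and_mem_iff hxy).1 ⟨hx, hy⟩⟩).reachable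

/-- An edge is a cut-edge iff its endpoints are not connected by the other open edges. -/
lemma isCutEdge_iff [Finite V] (S : Set G.edgeSet) (e : G.edgeSet) {x y : V}
    (he : (e : Sym2 V) = s(x, y)) :
    IsCutEdge S e ↔ ¬ (openGraph (S \ {e})).Reachable x y := by
  have hle : openGraph (S \ {e}) ≤ openGraph (S ∪ {e}) :=
    openGraph_mono fun f hf => Or.inl hf.1
  -- Both graphs have the same vertices, so φ is onto. As V is finite, the two component counts
  -- agree iff φ is injective, that is, iff adding e merges no two components.
  let φ := SimpleGraph.ConnectedComponent.map (SimpleGraph.Hom.ofLE hle)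
  have hsurj : Function.Surjective φ := by
    intro c
    induction c using SimpleGraph.ConnectedComponent.ind with
    | h v => exact ⟨(openGraph (S \ {e})).connectedComponentMk v, rfl⟩
  have hxe : x ∈ (e : Sym2 V) := by rw [he]; exact Sym2.mem_mk_left x y
  have hye : y ∈ (e : Sym2 V) := by rw [he]; exact Sym2.mem_mk_right x y
  unfold IsCutEdge numComponents
  constructor
  · intro h hr
    apply h
    refine Nat.card_congr (Equiv.ofBijective φ ⟨?_, hsurj⟩)
    intro c c' hcc
    induction c using SimpleGraph.ConnectedComponent.ind with
    | h u =>
    induction c' using SimpleGraph.ConnectedComponent.ind with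
    | h v =>
    have huv : (openGraph (S ∪ {e})).Reachable u v := SimpleGraph.ConnectedComponent.exact hcc
    refine SimpleGraph.ConnectedComponent.sound ?_
    clear hcc
    rw [SimpleGraph.reachable_iff_reflTransGen] at huv
    induction huv with
    | refl => exact SimpleGraph.Reachable.refl _
    | @tail a b h1 hab ih =>
      refine ih.trans ?_
      obtain ⟨f, hf, hfe⟩ := openGraph_adj.1 hab
      by_cases hfe' : f = e
      · subst hfe'
        rw [he] at hfe
        rcases Sym2.eq_iff.1 hfe with ⟨rfl, rfl⟩ | ⟨rfl, rfl⟩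
        · exact hr
        · exact hr.symm
      · refine (openGraph_adj (S := S \ {e}).2 ⟨f, ⟨?_, hfe'⟩, hfe⟩).reachable
        rcases hf with hf | hf
        · exact hf
        · exact absurd hf hfe'
  · intro hr h
    apply hr
    have hbij : Function.Bijective φ :=
      (Nat.bijective_iff_surjective_and_card φ).2 ⟨hsurj, h⟩
    refine SimpleGraph.ConnectedComponent.exact (hbij.1 ?_)
    exact SimpleGraph.ConnectedComponent.sound
      (reachable_of_mem (S := S ∪ {e}) (f := e) (Or.inr rfl) hxe hye)

lemma mem_conn_self {w : G.edgeSet} {S : Set G.edgeSet} (h : w ∈ S) : w ∈ conn w S := by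
  obtain ⟨x, hx⟩ : ∃ x, x ∈ (w : Sym2 V) := ⟨_, Sym2.out_fst_mem _⟩
  exact ⟨h, h, x, hx, x, hx, SimpleGraph.Reachable.refl _⟩

/-- An open edge connected to an edge of an open component belongs to this component. -/
lemma mem_conn_of_reachable {w e f : G.edgeSet} {Ξ : Set G.edgeSet} (he : e ∈ conn w Ξ)
    (hf : f ∈ Ξ) {x y : V} (hx : x ∈ (e : Sym2 V)) (hy : y ∈ (f : Sym2 V))
    (h : (openGraph Ξ).Reachable x y) : f ∈ conn w Ξ := by
  obtain ⟨hw, heΞ, a, ha, b, hb, hab⟩ := he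
  exact ⟨hw, hf, a, ha, y, hy, (hab.trans (reachable_of_mem heΞ hb hx)).trans h⟩

/-- A path in S ∖ {e} from an endpoint of e stays in one component of Ξ, so its edges lie in `conn w
Ξ`, where S is contained in S'. Reachability in Ξ is carried through the induction to locate the
next edge. -/
lemma reachable_of_conn {S S' Ξ : Set G.edgeSet} {w e : G.edgeSet} (hS : S ⊆ Ξ)
    (hSS' : S ∩ conn w Ξ ⊆ S') (he : e ∈ conn w Ξ) {x y : V} (hx : x ∈ (e : Sym2 V))
    (h : (openGraph (S \ {e})).Reachable x y) : (openGraph (S' \ {e})).Reachable x y := by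
  suffices (openGraph Ξ).Reachable x y ∧ (openGraph (S' \ {e})).Reachable x y from this.2
  rw [SimpleGraph.reachable_iff_reflTransGen] at h
  induction h with
  | refl => exact ⟨SimpleGraph.Reachable.refl _, SimpleGraph.Reachable.refl _⟩
  | @tail a b h1 hab ih =>
    obtain ⟨f, ⟨hf, hfe⟩, hfab⟩ := openGraph_adj.1 hab
    have haf : a ∈ (f : Sym2 V) := by rw [hfab]; exact Sym2.mem_mk_left a b
    have hfK : f ∈ conn w Ξ := mem_conn_of_reachable he (hS hf) hx haf ih.1
    exact ⟨ih.1.trans (openGraph_adj.2 ⟨f, hS hf, hfab⟩).reachable,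
      ih.2.trans (openGraph_adj (S := S' \ {e}).2 ⟨f, ⟨hSS' ⟨hf, hfK⟩, hfe⟩, hfab⟩).reachable⟩

/-- Inside an open component of `Ξ`, being a cut-edge in `S ⊆ Ξ` depends only on the restriction
of `S` to this component. -/
lemma isCutEdge_congr [Finite V] {S S' Ξ : Set G.edgeSet} {w e : G.edgeSet} (hS : S ⊆ Ξ)
    (hS' : S' ⊆ Ξ) (h : S ∩ conn w Ξ = S' ∩ conn w Ξ) (he : e ∈ conn w Ξ) :
    IsCutEdge S e ↔ IsCutEdge S' e := by
  obtain ⟨x, y, hxy⟩ : ∃ x y, (e : Sym2 V) = s(x, y) := by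
    induction h : (e : Sym2 V) with
    | h x y => exact ⟨x, y, rfl⟩
  have hx : x ∈ (e : Sym2 V) := by rw [hxy]; exact Sym2.mem_mk_left x y
  rw [isCutEdge_iff S e hxy, isCutEdge_iff S' e hxy, not_iff_not]
  exact ⟨reachable_of_conn hS (h ▸ Set.inter_subset_left) he hx,
    reachable_of_conn hS' (h ▸ Set.inter_subset_left) he hx⟩

lemma conn_subset_connBar (e : G.edgeSet) (S : Set G.edgeSet) : conn e S ⊆ connBar e S :=
  Set.subset_union_left

end CutEdges

/-! ### Running the dynamics over a finite set of times -/

section Evolution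

variable {V : Type*} {G : SimpleGraph V} {p q : ℝ}

/-- The updates at the times in `F` are applied in chronological order. -/
noncomputable def evolve (p q : ℝ) (upd : G.edgeSet → Set (ℝ × ℝ)) (F : Finset ℝ)
    (S : Set G.edgeSet) : Set G.edgeSet :=
  (F.sort (· ≤ ·)).foldl (applyUpdates p q upd) S

lemma fkState_of_finite {upd : G.edgeSet → Set (ℝ × ℝ)} {t : ℝ}
    (h : (updateTimes upd t).Finite) (x₀ : Set G.edgeSet) :
    fkState p q upd x₀ t = evolve p q upd h.toFinset x₀ := by
  rw [fkState, dif_pos h, evolve]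

variable (upd : G.edgeSet → Set (ℝ × ℝ))

@[simp] lemma evolve_empty (S : Set G.edgeSet) : evolve p q upd ∅ S = S := by
  simp [evolve]

/-- The largest time comes last. With `Finset.induction_on_max`, statements on `evolve` reduce to
the effect of one further update time. -/
lemma evolve_insert_max {F : Finset ℝ} {t : ℝ} (h : ∀ s ∈ F, s < t) (S : Set G.edgeSet) :
    evolve p q upd (insert t F) S = applyUpdates p q upd (evolve p q upd F S) t := by
  have hsort : (insert t F).sort (· ≤ ·) = F.sort (· ≤ ·) ++ [t] := by
    refine List.Perm.eq_of_pairwise' (r := (· ≤ ·)) (Finset.pairwise_sort _ _) ?_ ?_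
    · rw [List.pairwise_append]
      refine ⟨Finset.pairwise_sort _ _, List.pairwise_singleton _ _, ?_⟩
      intro a ha b hb
      rw [List.mem_singleton] at hb
      rw [Finset.mem_sort] at ha
      exact hb ▸ (h a ha).le
    · refine (List.perm_ext_iff_of_nodup (Finset.sort_nodup _ _) ?_).2 ?_
      · rw [List.nodup_append]
        refine ⟨Finset.sort_nodup _ _, List.nodup_singleton _, ?_⟩
        intro a ha b hb
        rw [List.mem_singleton] at hb
        rw [Finset.mem_sort] at ha
        exact hb ▸ (h a ha).ne
      · intro a
        simp [or_comm]
  rw [evolve, hsort, List.foldl_append]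
  rfl

lemma evolve_union {F₁ F₂ : Finset ℝ} (h : ∀ s ∈ F₁, ∀ t ∈ F₂, s < t) (S : Set G.edgeSet) :
    evolve p q upd (F₁ ∪ F₂) S = evolve p q upd F₂ (evolve p q upd F₁ S) := by
  induction F₂ using Finset.induction_on_max with
  | empty => simp
  | insert t F₂ ht ih =>
    rw [Finset.union_insert, evolve_insert_max, evolve_insert_max _ ht, ih]
    · exact fun s hs u hu => h s hs u (Finset.mem_insert_of_mem hu)
    · intro s hs
      rcases Finset.mem_union.1 hs with hs | hs
      · exact h s hs t (Finset.mem_insert_self _ _)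
      · exact ht s hs

variable {upd}

lemma mem_applyUpdates_of_forall_notMem {S : Set G.edgeSet} {t : ℝ} {e : G.edgeSet}
    (h : ∀ U, (t, U) ∉ upd e) : e ∈ applyUpdates p q upd S t ↔ e ∈ S := by
  simp only [applyUpdates, Set.mem_ofPred_eq]
  constructor
  · rintro (⟨U, hU, -⟩ | ⟨-, h⟩)
    · exact absurd hU (h U)
    · exact h
  · exact fun hS => Or.inr ⟨h, hS⟩

/-- A time without updates acts as the identity. This lets two dynamics with different updates be
run over the same set of times. -/
lemma evolve_eq_of_subset {F F' : Finset ℝ} (hFF' : F' ⊆ F)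
    (h : ∀ t ∈ F, t ∉ F' → ∀ e U, (t, U) ∉ upd e) (S : Set G.edgeSet) :
    evolve p q upd F' S = evolve p q upd F S := by
  induction F using Finset.induction_on_max generalizing F' with
  | empty => rw [Finset.subset_empty.1 hFF']
  | insert t F ht ih =>
    have htF : t ∉ F := fun h => lt_irrefl _ (ht t h)
    have herase : F'.erase t ⊆ F := by
      intro s hs
      rw [Finset.mem_erase] at hs
      exact (Finset.mem_insert.1 (hFF' hs.2)).resolve_left hs.1
    have ih := ih herase (fun s hs hs' =>
      h s (Finset.mem_insert_of_mem hs) fun hsF' =>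
        hs' (Finset.mem_erase.2 ⟨fun hst => htF (hst ▸ hs), hsF'⟩))
    rw [evolve_insert_max _ ht, ← ih]
    by_cases htF' : t ∈ F'
    · nth_rw 1 [← Finset.insert_erase htF']
      exact evolve_insert_max _ (fun s hs => ht s (herase hs)) S
    · rw [Finset.erase_eq_of_notMem htF']
      ext e
      exact (mem_applyUpdates_of_forall_notMem
        (h t (Finset.mem_insert_self _ _) htF' e)).symm

lemma mem_evolve_of_forall_notMem {F : Finset ℝ} {e : G.edgeSet}
    (h : ∀ t ∈ F, ∀ U, (t, U) ∉ upd e) (S : Set G.edgeSet) :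
    e ∈ evolve p q upd F S ↔ e ∈ S := by
  induction F using Finset.induction_on_max with
  | empty => simp
  | insert t F ht ih =>
    rw [evolve_insert_max _ ht, mem_applyUpdates_of_forall_notMem
      (h t (Finset.mem_insert_self _ _)), ih fun s hs => h s (Finset.mem_insert_of_mem hs)]

/-- What confines the open edges to the environment: only a mark U ≥ 1 - p can open an edge, and an
edge without update keeps its state. -/
lemma exists_of_mem_evolve {F : Finset ℝ} {e : G.edgeSet} {S : Set G.edgeSet}
    (h : e ∈ evolve p q upd F S) :
    (∃ t ∈ F, ∃ U, (t, U) ∈ upd e ∧ 1 - p ≤ U) ∨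
      (e ∈ S ∧ ∀ t ∈ F, ∀ U, (t, U) ∉ upd e) := by
  induction F using Finset.induction_on_max with
  | empty => exact Or.inr ⟨by simpa using h, by simp⟩
  | insert t F ht ih =>
    rw [evolve_insert_max _ ht] at h
    rcases h with ⟨U, hU, hpU, -⟩ | ⟨hU, h⟩
    · exact Or.inl ⟨t, Finset.mem_insert_self _ _, U, hU, hpU⟩
    · rcases ih h with ⟨s, hs, h⟩ | ⟨hS, h⟩
      · exact Or.inl ⟨s, Finset.mem_insert_of_mem hs, h⟩
      · refine Or.inr ⟨hS, fun s hs => ?_⟩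
        rcases Finset.mem_insert.1 hs with rfl | hs
        · exact hU
        · exact h s hs

/-- After an oblivious last update the state of an edge is given by the mark. -/
lemma mem_evolve_of_oblivious {F : Finset ℝ} {e : G.edgeSet} {t : ℝ} (ht : t ∈ F)
    (hup : ∃ U, (t, U) ∈ upd e) (hlast : ∀ s ∈ F, t < s → ∀ U, (s, U) ∉ upd e)
    (hobl : ∀ U, (t, U) ∈ upd e → U < 1 - p + pStar p q) (S : Set G.edgeSet) :
    e ∈ evolve p q upd F S ↔ ∃ U, (t, U) ∈ upd e ∧ 1 - p ≤ U := by
  induction F using Finset.induction_on_max with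
  | empty => simp at ht
  | insert s F hs ih =>
    rw [evolve_insert_max _ hs]
    rcases Finset.mem_insert.1 ht with rfl | htF
    · constructor
      · rintro (⟨U, hU, hpU, -⟩ | ⟨hU, -⟩)
        · exact ⟨U, hU, hpU⟩
        · exact absurd hup (by simpa using hU)
      · rintro ⟨U, hU, hpU⟩
        exact Or.inl ⟨U, hU, hpU, Or.inl (hobl U hU)⟩
    · rw [mem_applyUpdates_of_forall_notMem (hlast s (Finset.mem_insert_self _ _) (hs t htF)),
        ih htF fun u hu => hlast u (Finset.mem_insert_of_mem hu)]

/-- Two evolutions inside `Ξ` that agree on an open component of `Ξ` at the beginning, and whose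
updates agree there, agree on this component at the end. -/
lemma evolve_inter_conn [Finite V] {upd' : G.edgeSet → Set (ℝ × ℝ)} {F : Finset ℝ}
    {Ξ S S' : Set G.edgeSet} {w : G.edgeSet} (hS : S ⊆ Ξ) (hS' : S' ⊆ Ξ)
    (hSS' : S ∩ conn w Ξ = S' ∩ conn w Ξ)
    (hΞ : ∀ e, ∀ t ∈ F, ∀ U, (t, U) ∈ upd e → 1 - p ≤ U → e ∈ Ξ)
    (hsub : ∀ e, ∀ t ∈ F, ∀ U, (t, U) ∈ upd' e → (t, U) ∈ upd e)
    (hupd : ∀ e ∈ conn w Ξ, ∀ t ∈ F, ∀ U, (t, U) ∈ upd e → (t, U) ∈ upd' e) :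
    evolve p q upd F S ∩ conn w Ξ = evolve p q upd' F S' ∩ conn w Ξ := by
  -- Both evolutions stay inside Ξ, since only edges of Ξ can be opened; hence `isCutEdge_congr` is
  -- available before each update.
  have key : ∀ (u : G.edgeSet → Set (ℝ × ℝ)) (F' : Finset ℝ) (T : Set G.edgeSet), T ⊆ Ξ →
      (∀ e, ∀ t ∈ F', ∀ U, (t, U) ∈ u e → 1 - p ≤ U → e ∈ Ξ) → evolve p q u F' T ⊆ Ξ := by
    intro u F' T hT hu e he
    rcases exists_of_mem_evolve he with ⟨t, ht, U, hU, hpU⟩ | ⟨h, -⟩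
    · exact hu e t ht U hU hpU
    · exact hT h
  induction F using Finset.induction_on_max with
  | empty => simpa using hSS'
  | insert t F ht ih =>
    have hmem : ∀ s ∈ F, s ∈ insert t F := fun s hs => Finset.mem_insert_of_mem hs
    have htm := Finset.mem_insert_self t F
    have ih := ih (fun e s hs => hΞ e s (hmem s hs)) (fun e s hs => hsub e s (hmem s hs))
      (fun e he s hs => hupd e he s (hmem s hs))
    rw [evolve_insert_max _ ht, evolve_insert_max _ ht]
    have h1 : evolve p q upd F S ⊆ Ξ := key upd F S hS fun e s hs => hΞ e s (hmem s hs)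
    have h2 : evolve p q upd' F S' ⊆ Ξ := key upd' F S' hS' fun e s hs U hU hpU =>
      hΞ e s (hmem s hs) U (hsub e s (hmem s hs) U hU) hpU
    have hU : ∀ e ∈ conn w Ξ, ∀ U, (t, U) ∈ upd e ↔ (t, U) ∈ upd' e := fun e he U =>
      ⟨hupd e he t htm U, hsub e t htm U⟩
    ext e
    simp only [Set.mem_inter_iff, and_congr_left_iff]
    intro he
    have h3 : e ∈ evolve p q upd F S ↔ e ∈ evolve p q upd' F S' :=
      ⟨fun h => (ih.le ⟨h, he⟩).1, fun h => (ih.ge ⟨h, he⟩).1⟩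
    simp only [applyUpdates, Set.mem_ofPred_eq, hU e he, isCutEdge_congr h1 h2 ih he, h3]

end Evolution

/-! ### The dynamics in a time slab -/

section Slab

lemma tau_nonneg (p : ℝ) (i : ℕ) : 0 ≤ tau p i :=
  mul_nonneg (Nat.cast_nonneg i) (inv_nonneg.2 (Real.sqrt_nonneg p))

lemma tau_mono (p : ℝ) : Monotone (tau p) := fun _ _ h =>
  mul_le_mul_of_nonneg_right (Nat.cast_le.2 h) (inv_nonneg.2 (Real.sqrt_nonneg p))

lemma tau_le_tau_succ (p : ℝ) (i : ℕ) : tau p i ≤ tau p (i + 1) := tau_mono p i.le_succ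

lemma pStar_pos {p q : ℝ} (hp₀ : 0 < p) (hp₁ : p < 1) (hq : 1 < q) : 0 < pStar p q := by
  have : 0 < q * (1 - p) := mul_pos (by linarith) (by linarith)
  exact div_pos hp₀ (by linarith)

/-- An edge is open at some time of the slab, in the dynamics started empty, iff some update of
this edge in the slab opens it. -/
lemma mem_enlargedEmpty {E : Type*} {p : ℝ} {upd : E → Set (ℝ × ℝ)} {i : ℕ} {e : E} :
    e ∈ enlargedEmpty p upd i ↔ ∃ a ∈ updIn upd (tau p i) (tau p (i + 1)) e, 1 - p < a.2 := by
  constructor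
  · rintro ⟨t, ht, a, ha, hpa⟩
    exact ⟨a, ⟨ha.1.1, ha.1.2.1, ha.1.2.2.trans ht.2⟩, hpa⟩
  · rintro ⟨a, ⟨ha, ha1, ha2⟩, hpa⟩
    exact ⟨a.1, ⟨ha1.le, ha2⟩, a, ⟨⟨ha, ha1, le_rfl⟩, fun b hb => hb.2.2⟩, hpa⟩

variable {V : Type*} {G : SimpleGraph V} {p q : ℝ} {upd : G.edgeSet → Set (ℝ × ℝ)}

/-- The properties of the realizations of the update sequence that hold almost surely and are used
in the analysis of the dynamics. -/
structure Regular (p : ℝ) (upd : G.edgeSet → Set (ℝ × ℝ)) : Prop where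
  finite : ∀ t, (updateTimes upd t).Finite
  mark_ne : ∀ e, ∀ a ∈ upd e, a.2 ≠ 1 - p

/-- Flow property: the update times in (0, t] split at s, and those up to s come first. -/
lemma fkState_step {s t : ℝ} (hst : s ≤ t) (h : (updateTimes upd t).Finite)
    (x₀ : Set G.edgeSet) :
    fkState p q upd x₀ t =
      evolve p q upd (h.toFinset.filter (s < ·)) (fkState p q upd x₀ s) := by
  have hs : (updateTimes upd s).Finite := h.subset fun u hu => ⟨hu.1, hu.2.1.trans hst, hu.2.2⟩
  rw [fkState_of_finite h, fkState_of_finite hs, ← evolve_union]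
  · congr 1
    ext u
    simp only [Set.Finite.mem_toFinset, Finset.mem_union, Finset.mem_filter]
    constructor
    · intro hu
      rcases le_or_gt u s with hus | hus
      · exact Or.inl ⟨hu.1, hus, hu.2.2⟩
      · exact Or.inr ⟨hu, hus⟩
    · rintro (hu | hu)
      · exact ⟨hu.1, hu.2.1.trans hst, hu.2.2⟩
      · exact hu.1
  · intro u hu v hv
    rw [Set.Finite.mem_toFinset] at hu
    exact hu.2.1.trans_lt (Finset.mem_filter.1 hv).2

lemma mem_slabTimes {i : ℕ} (h : (updateTimes upd (tau p (i + 1))).Finite) {t : ℝ} :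
    t ∈ h.toFinset.filter (tau p i < ·) ↔
      tau p i < t ∧ t ≤ tau p (i + 1) ∧ ∃ e U, (t, U) ∈ upd e := by
  simp only [Finset.mem_filter, Set.Finite.mem_toFinset, updateTimes, Set.mem_ofPred_eq]
  constructor
  · rintro ⟨⟨-, h1, h2⟩, h3⟩
    exact ⟨h3, h1, h2⟩
  · rintro ⟨h3, h1, h2⟩
    exact ⟨⟨(tau_nonneg p i).trans_lt h3, h1, h2⟩, h3⟩

/-- The dynamics can open an edge when U ≥ 1 - p, whereas the environment asks for U > 1 - p;
regularity excludes the only discrepancy, U = 1 - p. -/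
lemma Regular.mem_enlargedEmpty_of_le (hreg : Regular p upd) {i : ℕ} {e : G.edgeSet} {t U : ℝ}
    (hU : (t, U) ∈ upd e) (h1 : tau p i < t) (h2 : t ≤ tau p (i + 1)) (hpU : 1 - p ≤ U) :
    e ∈ enlargedEmpty p upd i :=
  mem_enlargedEmpty.2 ⟨(t, U), ⟨hU, h1, h2⟩, lt_of_le_of_ne hpU (hreg.mark_ne e _ hU).symm⟩

/-- The open edges at the end of a slab belong to the environment of this slab. -/
lemma Regular.fkState_subset_env (hreg : Regular p upd) (i : ℕ) (x₀ : Set G.edgeSet) :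
    fkState p q upd x₀ (tau p (i + 1)) ⊆ env p upd i := by
  intro e he
  rw [fkState_step (tau_le_tau_succ p i) (hreg.finite _)] at he
  rcases exists_of_mem_evolve he with ⟨t, ht, U, hU, hpU⟩ | ⟨-, h⟩
  · rw [mem_slabTimes] at ht
    exact Or.inl (hreg.mem_enlargedEmpty_of_le hU ht.1 ht.2.1 hpU)
  · refine Or.inr (Set.eq_empty_iff_forall_notMem.2 ?_)
    rintro ⟨t, U⟩ ⟨hU, h1, h2⟩
    exact h t ((mem_slabTimes _).2 ⟨h1, h2, e, U, hU⟩) U hU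

/-- As p* > 0, a non-oblivious mark exceeds 1 - p. Hence the component from which such an edge
spreads is never empty. -/
lemma mem_env_of_mem_nonOblivious (hp₀ : 0 < p) (hp₁ : p < 1) (hq : 1 < q) {i : ℕ}
    {e : G.edgeSet} (h : e ∈ nonOblivious p q upd i) : e ∈ env p upd i := by
  obtain ⟨a, ha, hpa⟩ := h
  have := pStar_pos hp₀ hp₁ hq
  exact Or.inl (mem_enlargedEmpty.2 ⟨a, ha.1, by linarith⟩)

/-- The realization of the update sequence recorded by a set of updates. -/
def updOf {E : Type*} (u : Set (E × ℝ × ℝ)) (e : E) : Set (ℝ × ℝ) := {a | (e, a) ∈ u}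

/-- The configuration on `W` at the end of a slab is obtained by running the dynamics from the
configuration on `D`, with the updates on `M` only. -/
theorem Regular.fkState_inter_eq [Finite V] (hreg : Regular p upd) (hp₀ : 0 < p) (hp₁ : p < 1)
    (hq : 1 < q) {i : ℕ} (hi : 1 ≤ i) {W D M : Set G.edgeSet}
    (hD : stepBack p q upd i W ⊆ D) (hWM : W ⊆ M) (hM : spread p q upd i W ⊆ M)
    (x₀ : Set G.edgeSet) :
    fkState p q upd x₀ (tau p (i + 1)) ∩ W =
      fkState p q (updOf (updOn upd (tau p i) (tau p (i + 1)) M))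
        (fkState p q upd x₀ (tau p i) ∩ D) (tau p (i + 1)) ∩ W := by
  set upd' := updOf (updOn upd (tau p i) (tau p (i + 1)) M)
  set X := fkState p q upd x₀ (tau p i)
  have hfin := hreg.finite (tau p (i + 1))
  have hfin' : (updateTimes upd' (tau p (i + 1))).Finite :=
    hfin.subset fun t ⟨h1, h2, e, U, h3⟩ => ⟨h1, h2, e, U, h3.2.1⟩
  set F := hfin.toFinset.filter (tau p i < ·)
  -- All updates of `upd'` come after τ_i, so its dynamics, although started at time 0, performs
  -- only those of the slab; the other times in F are harmless.
  have hrun : fkState p q upd' (X ∩ D) (tau p (i + 1)) = evolve p q upd' F (X ∩ D) := by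
    rw [fkState_of_finite hfin']
    refine evolve_eq_of_subset ?_ ?_ _
    · intro t ht
      rw [Set.Finite.mem_toFinset] at ht
      obtain ⟨-, h2, e, U, h3⟩ := ht
      exact (mem_slabTimes _).2 ⟨h3.2.2.1, h2, e, U, h3.2.1⟩
    · intro t ht ht' e U hU
      refine ht' ?_
      rw [mem_slabTimes] at ht
      rw [Set.Finite.mem_toFinset]
      exact ⟨(tau_nonneg p i).trans_lt ht.1, ht.2.1, e, U, hU⟩
  rw [fkState_step (tau_le_tau_succ p i) hfin, hrun]
  -- The reason for Ξ_{i-1} in the definition of the history, and the place where i ≥ 1 is needed.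
  have hX : X ⊆ env p upd (i - 1) := by
    have := hreg.fkState_subset_env (q := q) (i - 1) x₀
    rwa [Nat.sub_add_cancel hi] at this
  ext w
  simp only [Set.mem_inter_iff, and_congr_left_iff]
  intro hw
  -- Three cases: after a non-oblivious last update the component of w in Ξ decides; without update
  -- the state at τ_i is kept; after an oblivious last update the mark decides.
  by_cases hno : w ∈ nonOblivious p q upd i
  · set Ξ := env p upd (i - 1) ∪ env p upd i
    have hwΞ : w ∈ Ξ := Or.inr (mem_env_of_mem_nonOblivious hp₀ hp₁ hq hno)
    have hsp : conn w Ξ ⊆ spread p q upd i W := fun e he =>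
      Set.mem_biUnion (show w ∈ W ∩ nonOblivious p q upd i from ⟨hw, hno⟩)
        (conn_subset_connBar w Ξ he)
    have hXΞ : X ⊆ Ξ := fun e he => Or.inl (hX he)
    have hD' : conn w Ξ ⊆ D := fun e he => hD (Or.inr (hsp he))
    have key := evolve_inter_conn (p := p) (q := q) (upd := upd) (upd' := upd') (F := F)
      (w := w) hXΞ (Set.inter_subset_left.trans hXΞ)
      (show X ∩ conn w Ξ = X ∩ D ∩ conn w Ξ by
        rw [Set.inter_assoc, Set.inter_eq_self_of_subset_right hD'])
      (fun e t ht U hU hpU => Or.inr (Or.inl (hreg.mem_enlargedEmpty_of_le hU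
        ((mem_slabTimes _).1 ht).1 ((mem_slabTimes _).1 ht).2.1 hpU)))
      (fun e t _ U hU => hU.2.1)
      (fun e he t ht U hU => ⟨hM (hsp he), hU, ((mem_slabTimes _).1 ht).1,
        ((mem_slabTimes _).1 ht).2.1⟩)
    have hwc := mem_conn_self hwΞ
    exact ⟨fun h => (key.le ⟨h, hwc⟩).1, fun h => (key.ge ⟨h, hwc⟩).1⟩
  · have hiff : ∀ t ∈ F, ∀ U, (t, U) ∈ upd w ↔ (t, U) ∈ upd' w := fun t ht U =>
      ⟨fun h => ⟨hWM hw, h, ((mem_slabTimes _).1 ht).1, ((mem_slabTimes _).1 ht).2.1⟩,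
        fun h => h.2.1⟩
    by_cases hnu : ∀ t ∈ F, ∀ U, (t, U) ∉ upd w
    · rw [mem_evolve_of_forall_notMem hnu, mem_evolve_of_forall_notMem
        fun t ht U hU => hnu t ht U ((hiff t ht U).2 hU)]
      have hwD : w ∈ D := by
        refine hD (Or.inl ⟨hw, Set.eq_empty_iff_forall_notMem.2 ?_⟩)
        rintro ⟨t, U⟩ ⟨hU, h1, h2⟩
        exact hnu t ((mem_slabTimes _).2 ⟨h1, h2, w, U, hU⟩) U hU
      exact ⟨fun h => ⟨h, hwD⟩, fun h => h.1⟩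
    · push Not at hnu
      let Fw := {t ∈ (F : Set ℝ) | ∃ U, (t, U) ∈ upd w}
      have hne : Fw.Nonempty := by
        obtain ⟨t, ht, U, hU⟩ := hnu
        exact ⟨t, ht, U, hU⟩
      obtain ⟨t, ⟨htF, hup⟩, hmax⟩ :=
        (F.finite_toSet.subset (Set.sep_subset _ _)).exists_maximalFor id Fw hne
      have hlast : ∀ s ∈ F, ∀ U, (s, U) ∈ upd w → s ≤ t := fun s hs U hU => by
        by_contra! hts
        exact hts.not_ge (hmax ⟨hs, U, hU⟩ hts.le)
      -- Every update of w at its last update time t counts as a last update, so simultaneous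
      -- updates of w need not be excluded.
      have hobl : ∀ U, (t, U) ∈ upd w → U < 1 - p + pStar p q := by
        intro U hU
        by_contra hlt
        have ht := (mem_slabTimes _).1 htF
        refine hno ⟨(t, U), ⟨⟨hU, ht.1, ht.2.1⟩, ?_⟩, hlt⟩
        rintro ⟨s, U'⟩ ⟨hU', h1, h2⟩
        exact hlast s ((mem_slabTimes _).2 ⟨h1, h2, w, U', hU'⟩) U' hU'
      rw [mem_evolve_of_oblivious htF hup (fun s hs hts U hU => hts.not_ge (hlast s hs U hU)) hobl,
        mem_evolve_of_oblivious htF (hup.imp fun U hU => (hiff t htF U).1 hU)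
          (fun s hs hts U hU => hts.not_ge (hlast s hs U ((hiff s hs U).2 hU)))
          (fun U hU => hobl U ((hiff t htF U).2 hU))]
      simp [hiff t htF]

end Slab

/-! ### Histories -/

section Histories

variable {V : Type*} {G : SimpleGraph V} {p q : ℝ} {upd upd' : G.edgeSet → Set (ℝ × ℝ)}

lemma historyBack_sub_eq {m k : ℕ} (hk : k + 1 ≤ m) (e : G.edgeSet) :
    historyBack p q upd m e (m - k) =
      stepBack p q upd k (historyBack p q upd m e (m - (k + 1))) := by
  obtain ⟨j, hj⟩ : ∃ j, m - k = j + 1 := ⟨m - (k + 1), by omega⟩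
  have h1 : m - (k + 1) = j := by omega
  have h2 : m - (j + 1) = k := by omega
  rw [hj, h1, historyBack, h2]

lemma historyDiagram_at {m k : ℕ} (hk : 1 ≤ k) (hkm : k ≤ m) (e : G.edgeSet) :
    (historyDiagram p q upd m).at_ e k = historyBack p q upd m e (m - k) := by
  ext; simp [historyDiagram, hk, hkm]

lemma historyDiagram_mid {m k : ℕ} (hk : 1 ≤ k) (hkm : k + 1 ≤ m) (e : G.edgeSet) :
    (historyDiagram p q upd m).mid e k =
      (historyDiagram p q upd m).at_ e (k + 1) ∪
        spread p q upd k ((historyDiagram p q upd m).at_ e (k + 1)) := by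
  rw [historyDiagram_at (by omega) hkm]
  ext; simp [historyDiagram, hk, Nat.lt_of_succ_le hkm]

lemma historyDiagram_at_eq_stepBack {m k : ℕ} (hk : 1 ≤ k) (hkm : k + 1 ≤ m) (e : G.edgeSet) :
    (historyDiagram p q upd m).at_ e k =
      stepBack p q upd k ((historyDiagram p q upd m).at_ e (k + 1)) := by
  rw [historyDiagram_at hk (by omega), historyDiagram_at (by omega) hkm, historyBack_sub_eq hkm]

lemma spread_iUnion (i : ℕ) (A : Set G.edgeSet) (W : G.edgeSet → Set G.edgeSet) :
    spread p q upd i (⋃ e ∈ A, W e) = ⋃ e ∈ A, spread p q upd i (W e) := by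
  ext f
  simp only [spread, Set.mem_iUnion, Set.mem_inter_iff, exists_prop]
  constructor
  · rintro ⟨w, ⟨⟨e, he, hw⟩, hno⟩, hf⟩
    exact ⟨e, he, w, ⟨hw, hno⟩, hf⟩
  · rintro ⟨e, he, w, ⟨hw, hno⟩, hf⟩
    exact ⟨w, ⟨⟨e, he, hw⟩, hno⟩, hf⟩

/-- The configuration on `𝓗_A(τ_{i+1})` is determined by the configuration on `𝓗_A(τ_i)` and the
updates on `𝓗_A(τ_{i+1/2})`. -/
theorem Regular.fkState_inter_atSet [Finite V] (hreg : Regular p upd) (hp₀ : 0 < p) (hp₁ : p < 1)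
    (hq : 1 < q) {m i : ℕ} (hi : 1 ≤ i) (him : i + 1 ≤ m) {H : HistoryDiagram G.edgeSet}
    (hH : historyDiagram p q upd m = H) (A : Set G.edgeSet) (x₀ : Set G.edgeSet) :
    fkState p q upd x₀ (tau p (i + 1)) ∩ H.atSet A (i + 1) =
      fkState p q (updOf (updOn upd (tau p i) (tau p (i + 1)) (H.midSet A i)))
        (fkState p q upd x₀ (tau p i) ∩ H.atSet A i) (tau p (i + 1)) ∩ H.atSet A (i + 1) := by
  subst hH
  have hspread := spread_iUnion (p := p) (q := q) (upd := upd) i A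
    fun e => (historyDiagram p q upd m).at_ e (i + 1)
  refine hreg.fkState_inter_eq hp₀ hp₁ hq hi ?_ ?_ ?_ x₀
  · rintro f (⟨hf, hnu⟩ | hf)
    · obtain ⟨e, he, hf⟩ := Set.mem_iUnion₂.1 hf
      refine Set.mem_iUnion₂.2 ⟨e, he, ?_⟩
      rw [historyDiagram_at_eq_stepBack hi him]
      exact Or.inl ⟨hf, hnu⟩
    · rw [HistoryDiagram.atSet, hspread] at hf
      obtain ⟨e, he, hf⟩ := Set.mem_iUnion₂.1 hf
      refine Set.mem_iUnion₂.2 ⟨e, he, ?_⟩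
      rw [historyDiagram_at_eq_stepBack hi him]
      exact Or.inr hf
  · refine Set.iUnion₂_mono fun e _ => ?_
    rw [historyDiagram_mid hi him]
    exact Set.subset_union_left
  · rw [HistoryDiagram.atSet, hspread]
    refine Set.iUnion₂_mono fun e _ => ?_
    rw [historyDiagram_mid hi him]
    exact Set.subset_union_right

/-- The component and its boundary depend only on the configuration on these edges. -/
lemma connBar_congr {w : G.edgeSet} {Ξ Ξ' : Set G.edgeSet} (hw : w ∈ Ξ)
    (h : ∀ f ∈ connBar w Ξ, f ∈ Ξ ↔ f ∈ Ξ') : connBar w Ξ' = connBar w Ξ := by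
  have hwc := mem_conn_self hw
  have hcover : ∀ x ∈ (w : Sym2 V), ∀ y, (openGraph Ξ).Reachable x y →
      ∃ g ∈ conn w Ξ, y ∈ (g : Sym2 V) := by
    intro x hx y hxy
    rw [SimpleGraph.reachable_iff_reflTransGen] at hxy
    rcases Relation.ReflTransGen.cases_tail hxy with rfl | ⟨a, hxa, hay⟩
    · exact ⟨w, hwc, hx⟩
    · obtain ⟨f, hf, hfe⟩ := openGraph_adj.1 hay
      refine ⟨f, mem_conn_of_reachable hwc hf hx ?_
        ((SimpleGraph.reachable_iff_reflTransGen _ _).2 hxa), ?_⟩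
      · rw [hfe]; exact Sym2.mem_mk_left a y
      · rw [hfe]; exact Sym2.mem_mk_right a y
  -- The boundary is used here: an edge of Ξ' touching the Ξ-component of w lies in the component or
  -- in its boundary, where Ξ and Ξ' agree. So Ξ' cannot extend the component.
  have hback : ∀ x ∈ (w : Sym2 V), ∀ y, (openGraph Ξ).Reachable x y → ∀ f ∈ Ξ',
      y ∈ (f : Sym2 V) → f ∈ Ξ := by
    intro x hx y hxy f hf hy
    obtain ⟨g, hg, hyg⟩ := hcover x hx y hxy
    by_cases hfc : f ∈ conn w Ξ
    · exact hfc.2.1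
    · exact (h f (Or.inr ⟨hfc, g, hg, y, hy, hyg⟩)).2 hf
  have hforth : ∀ f ∈ conn w Ξ, f ∈ Ξ' := fun f hf => (h f (Or.inl hf)).1 hf.2.1
  have hreach : ∀ x ∈ (w : Sym2 V), ∀ y,
      (openGraph Ξ').Reachable x y ↔ (openGraph Ξ).Reachable x y := by
    intro x hx y
    constructor
    · intro hxy
      rw [SimpleGraph.reachable_iff_reflTransGen] at hxy
      induction hxy with
      | refl => exact SimpleGraph.Reachable.refl _
      | @tail a b _ hab ih =>
        obtain ⟨f, hf, hfe⟩ := openGraph_adj.1 hab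
        refine ih.trans (openGraph_adj.2 ⟨f, hback x hx a ih f hf ?_, hfe⟩).reachable
        rw [hfe]; exact Sym2.mem_mk_left a b
    · intro hxy
      rw [SimpleGraph.reachable_iff_reflTransGen] at hxy
      induction hxy with
      | refl => exact SimpleGraph.Reachable.refl _
      | @tail a b hxa hab ih =>
        obtain ⟨f, hf, hfe⟩ := openGraph_adj.1 hab
        refine ih.trans (openGraph_adj.2 ⟨f, hforth f (mem_conn_of_reachable hwc hf hx ?_
          ((SimpleGraph.reachable_iff_reflTransGen _ _).2 hxa)), hfe⟩).reachable
        rw [hfe]; exact Sym2.mem_mk_left a b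
  have hconn : conn w Ξ' = conn w Ξ := by
    ext f
    constructor
    · rintro ⟨-, hf, x, hx, y, hy, hxy⟩
      rw [hreach x hx] at hxy
      exact ⟨hw, hback x hx y hxy f hf hy, x, hx, y, hy, hxy⟩
    · intro hf
      obtain ⟨-, -, x, hx, y, hy, hxy⟩ := id hf
      exact ⟨hforth w hwc, hforth f hf, x, hx, y, hy, (hreach x hx y).2 hxy⟩
  rw [connBar, hconn, connBar]

/-- The two realizations have the same updates of `e` in the `k`-th slab. -/
def AgreeAt {E : Type*} (p : ℝ) (upd upd' : E → Set (ℝ × ℝ)) (k : ℕ) (e : E) : Prop :=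
  updIn upd (tau p k) (tau p (k + 1)) e = updIn upd' (tau p k) (tau p (k + 1)) e

lemma AgreeAt.nonUpdate_iff {k : ℕ} {e : G.edgeSet} (h : AgreeAt p upd upd' k e) :
    e ∈ nonUpdate p upd k ↔ e ∈ nonUpdate p upd' k := by
  unfold AgreeAt at h
  simp only [nonUpdate, Set.mem_ofPred_eq, h]

lemma AgreeAt.nonOblivious_iff {k : ℕ} {e : G.edgeSet} (h : AgreeAt p upd upd' k e) :
    e ∈ nonOblivious p q upd k ↔ e ∈ nonOblivious p q upd' k := by
  unfold AgreeAt at h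
  simp only [nonOblivious, IsLastUpd, Set.mem_ofPred_eq, h]

lemma AgreeAt.env_iff {k : ℕ} {e : G.edgeSet} (h : AgreeAt p upd upd' k e) :
    e ∈ env p upd k ↔ e ∈ env p upd' k := by
  have h1 := h.nonUpdate_iff
  unfold AgreeAt at h
  simp only [env, Set.mem_union, mem_enlargedEmpty, h, h1]

/-- The last updates are inspected on W in slab k, and Ξ_{k-1} ∪ Ξ_k only on the spread itself,
whence agreement there in both slabs. -/
lemma spread_congr (hp₀ : 0 < p) (hp₁ : p < 1) (hq : 1 < q) {k : ℕ} {W : Set G.edgeSet}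
    (hW : ∀ w ∈ W, AgreeAt p upd upd' k w)
    (hs : ∀ f ∈ spread p q upd k W, AgreeAt p upd upd' k f ∧ AgreeAt p upd upd' (k - 1) f) :
    spread p q upd' k W = spread p q upd k W := by
  have hWn : W ∩ nonOblivious p q upd' k = W ∩ nonOblivious p q upd k := by
    ext w
    simp only [Set.mem_inter_iff, and_congr_right_iff]
    exact fun hw => (hW w hw).nonOblivious_iff.symm
  rw [spread, hWn, spread]
  refine Set.iUnion₂_congr fun w hw => connBar_congr ?_ fun f hf => ?_
  · exact Or.inr (mem_env_of_mem_nonOblivious hp₀ hp₁ hq hw.2)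
  · have := hs f (Set.mem_biUnion hw hf)
    exact or_congr this.2.env_iff this.1.env_iff

/-- The history of `e` is determined by the updates in its space-time neighbourhood `D`. -/
theorem historyDiagram_congr (hp₀ : 0 < p) (hp₁ : p < 1) (hq : 1 < q) {m : ℕ} {e : G.edgeSet}
    {D : ℕ → Set G.edgeSet} (hD : ∀ k < m, ∀ f ∈ D k, AgreeAt p upd upd' k f)
    (hmid : ∀ k, 1 ≤ k → k + 1 ≤ m → (historyDiagram p q upd m).mid e k ⊆ D k)
    (hat : ∀ k, 1 ≤ k → k + 1 ≤ m → (historyDiagram p q upd m).at_ e k ⊆ D (k - 1)) :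
    (historyDiagram p q upd' m).at_ e = (historyDiagram p q upd m).at_ e ∧
      (historyDiagram p q upd' m).mid e = (historyDiagram p q upd m).mid e := by
  have hW : ∀ k, 1 ≤ k → k + 1 ≤ m → ∀ w ∈ (historyDiagram p q upd m).at_ e (k + 1),
      AgreeAt p upd upd' k w := by
    intro k hk hkm w hw
    refine hD k hkm w (hmid k hk hkm ?_)
    rw [historyDiagram_mid hk hkm]
    exact Or.inl hw
  have hspread : ∀ k, 1 ≤ k → k + 1 ≤ m →
      spread p q upd' k ((historyDiagram p q upd m).at_ e (k + 1)) =
        spread p q upd k ((historyDiagram p q upd m).at_ e (k + 1)) := by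
    intro k hk hkm
    refine spread_congr hp₀ hp₁ hq (hW k hk hkm) fun f hf => ⟨?_, ?_⟩
    · refine hD k hkm f (hmid k hk hkm ?_)
      rw [historyDiagram_mid hk hkm]
      exact Or.inr hf
    -- In slab k - 1 this step inspects only edges reached by spreading, and these belong to
    -- 𝓗_e(τ_k).
    · refine hD (k - 1) (by omega) f (hat k hk hkm ?_)
      rw [historyDiagram_at_eq_stepBack hk hkm]
      exact Or.inr hf
  -- Induction backward in time from τ_m: once the two histories agree at τ_{k+1}, both spread from
  -- the same set.
  have hatj : ∀ j < m, (historyDiagram p q upd' m).at_ e (m - j) =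
      (historyDiagram p q upd m).at_ e (m - j) := by
    intro j
    induction j with
    | zero =>
      intro hj
      rw [historyDiagram_at (by omega) (by omega), historyDiagram_at (by omega) (by omega)]
      simp [historyBack]
    | succ j ih =>
      intro hj
      obtain ⟨k, hk⟩ : ∃ k, m - (j + 1) = k := ⟨_, rfl⟩
      have hk1 : 1 ≤ k := by omega
      have hkm : k + 1 ≤ m := by omega
      have hjk : m - j = k + 1 := by omega
      have ih := ih (by omega)
      rw [hjk] at ih
      rw [hk, historyDiagram_at_eq_stepBack hk1 hkm, historyDiagram_at_eq_stepBack hk1 hkm, ih,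
        stepBack, stepBack, hspread k hk1 hkm]
      congr 1
      ext w
      simp only [Set.mem_inter_iff, and_congr_right_iff]
      exact fun hw => (hW k hk1 hkm w hw).nonUpdate_iff.symm
  have hatk : (historyDiagram p q upd' m).at_ e = (historyDiagram p q upd m).at_ e := by
    funext k
    by_cases hk : 1 ≤ k ∧ k ≤ m
    · have := hatj (m - k) (by omega)
      rwa [Nat.sub_sub_self hk.2] at this
    · ext w
      exact ⟨fun h => absurd ⟨h.1, h.2.1⟩ hk, fun h => absurd ⟨h.1, h.2.1⟩ hk⟩
  refine ⟨hatk, ?_⟩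
  funext k
  by_cases hk : 1 ≤ k ∧ k + 1 ≤ m
  · rw [historyDiagram_mid hk.1 hk.2, historyDiagram_mid hk.1 hk.2, hatk, hspread k hk.1 hk.2]
  · ext w
    exact ⟨fun h => absurd ⟨h.1, h.2.1⟩ hk, fun h => absurd ⟨h.1, h.2.1⟩ hk⟩

lemma historyDiagram_at_subset_mid {m k : ℕ} (hk : 1 ≤ k) (hkm : k + 1 ≤ m) (e : G.edgeSet) :
    (historyDiagram p q upd m).at_ e (k + 1) ⊆ (historyDiagram p q upd m).mid e k := by
  rw [historyDiagram_mid hk hkm]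
  exact Set.subset_union_left

lemma stepBack_empty (i : ℕ) : stepBack p q upd i ∅ = ∅ := by
  simp [stepBack, spread]

/-- An empty history produces nothing further back. Level 0 is outside the diagram, hence empty by
convention. -/
lemma historyDiagram_eq_empty_of_le {m i : ℕ} (him : i + 1 ≤ m) {e : G.edgeSet}
    (h : (historyDiagram p q upd m).at_ e i = ∅) {k : ℕ} (hki : k ≤ i) :
    (historyDiagram p q upd m).at_ e k = ∅ := by
  induction i with
  | zero => rwa [Nat.le_zero.1 hki]
  | succ i ih =>
    rcases hki.eq_or_lt with rfl | hki
    · exact h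
    · refine ih (by omega) ?_ (by omega)
      rcases Nat.eq_zero_or_pos i with rfl | hi
      · ext w
        exact ⟨fun h => absurd h.1 (by simp), fun h => h.elim⟩
      · rw [historyDiagram_at_eq_stepBack hi (by omega), h, stepBack_empty]

end Histories

/-! ### Marked Poisson processes

A path records the successive waiting times and marks of a marked point process on `(0, ∞)`. -/

section Paths

open scoped ENNReal

/-- The time of the `k`-th point of a path. -/
def pathTime (ω : ℕ → ℝ × ℝ) (k : ℕ) : ℝ := ∑ j ∈ Finset.range (k + 1), (ω j).1

/-- The law of a waiting time and a mark. -/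
noncomputable def stepLaw : Measure (ℝ × ℝ) :=
  (expMeasure 1).prod (volume.restrict (Set.Icc (0 : ℝ) 1))

/-- The law of a marked Poisson process of rate one. -/
noncomputable def pathLaw : Measure (ℕ → ℝ × ℝ) := Measure.infinitePi fun _ => stepLaw

instance : IsProbabilityMeasure (expMeasure 1) := isProbabilityMeasure_expMeasure one_pos

instance : IsProbabilityMeasure (volume.restrict (Set.Icc (0 : ℝ) 1)) :=
  ⟨by simp⟩

instance : IsProbabilityMeasure stepLaw := by unfold stepLaw; infer_instance

instance : IsProbabilityMeasure pathLaw := by unfold pathLaw; infer_instance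

/-- The path that starts with `x` and continues with `ω`. -/
def consPath (x : ℝ × ℝ) (ω : ℕ → ℝ × ℝ) : ℕ → ℝ × ℝ
  | 0 => x
  | k + 1 => ω k

@[simp] lemma consPath_zero (x : ℝ × ℝ) (ω : ℕ → ℝ × ℝ) : consPath x ω 0 = x := rfl

@[simp] lemma consPath_succ (x : ℝ × ℝ) (ω : ℕ → ℝ × ℝ) (k : ℕ) :
    consPath x ω (k + 1) = ω k := rfl

@[fun_prop]
lemma measurable_consPath :
    Measurable fun a : (ℝ × ℝ) × (ℕ → ℝ × ℝ) => consPath a.1 a.2 := by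
  refine measurable_pi_lambda _ fun k => ?_
  cases k with
  | zero => exact measurable_fst
  | succ k => exact (measurable_pi_apply k).comp measurable_snd

@[fun_prop]
lemma measurable_pathTime (k : ℕ) : Measurable fun ω => pathTime ω k := by
  unfold pathTime
  fun_prop

lemma pathTime_consPath_zero (x : ℝ × ℝ) (ω : ℕ → ℝ × ℝ) : pathTime (consPath x ω) 0 = x.1 := by
  simp [pathTime, consPath]

lemma pathTime_consPath_succ (x : ℝ × ℝ) (ω : ℕ → ℝ × ℝ) (k : ℕ) :
    pathTime (consPath x ω) (k + 1) = x.1 + pathTime ω k := by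
  simp only [pathTime]
  rw [Finset.sum_range_succ' _ (k + 1), add_comm]
  rfl

/-- Renewal at the first point: the first step is independent of the others, which have the law of a
whole path. This is tested on finite cylinders, completed by `Set.univ` to initial segments of ℕ. -/
lemma map_consPath : (stepLaw.prod pathLaw).map (fun a => consPath a.1 a.2) = pathLaw := by
  refine Measure.eq_infinitePi _ fun s t ht => ?_
  classical
  obtain ⟨n, hn⟩ : ∃ n, s ⊆ Finset.range (n + 1) := by
    obtain ⟨n, hn⟩ := s.exists_nat_subset_range
    exact ⟨n, hn.trans (Finset.range_mono n.le_succ)⟩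
  let t' : ℕ → Set (ℝ × ℝ) := fun k => if k ∈ s then t k else Set.univ
  have ht' : ∀ k, MeasurableSet (t' k) := fun k => by
    by_cases hk : k ∈ s
    · simpa [t', hk] using ht k
    · simp [t', hk]
  have hprod : ∏ k ∈ s, stepLaw (t k) = ∏ k ∈ Finset.range (n + 1), stepLaw (t' k) := by
    rw [← Finset.prod_subset hn]
    · exact Finset.prod_congr rfl fun k hk => by simp [t', hk]
    · intro k _ hk
      simp [t', hk]
  have hpre : (fun a : (ℝ × ℝ) × (ℕ → ℝ × ℝ) => consPath a.1 a.2) ⁻¹' (Set.pi s t) =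
      t' 0 ×ˢ Set.pi (Finset.range n) fun k => t' (k + 1) := by
    ext ⟨x, ω⟩
    simp only [Set.mem_preimage, Set.mem_pi, Finset.mem_coe, Set.mem_prod, Finset.mem_range]
    constructor
    · intro h
      refine ⟨?_, fun k _ => ?_⟩
      · by_cases hk : 0 ∈ s
        · simpa [t', hk] using h 0 hk
        · simp [t', hk]
      · by_cases hk : k + 1 ∈ s
        · simpa [t', hk] using h (k + 1) hk
        · simp [t', hk]
    · rintro ⟨h0, h⟩ k hk
      cases k with
      | zero => simpa [t', hk] using h0
      | succ k => simpa [t', hk] using h k (by simpa using hn hk)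
  rw [Measure.map_apply measurable_consPath (.pi s.countable_toSet fun k _ => ht k), hpre,
    Measure.prod_prod, hprod, Finset.prod_range_succ', mul_comm]
  congr 1
  exact Measure.infinitePi_pi _ fun k _ => ht' (k + 1)

/-! ### Memorylessness -/

lemma expMeasure_Iic (x : ℝ) :
    expMeasure 1 (Set.Iic x) = ENNReal.ofReal (if 0 ≤ x then 1 - Real.exp (-x) else 0) := by
  rw [← ofReal_cdf, cdf_expMeasure_eq one_pos]
  simp

lemma expMeasure_Ioi {t : ℝ} (ht : 0 ≤ t) :
    expMeasure 1 (Set.Ioi t) = ENNReal.ofReal (Real.exp (-t)) := by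
  rw [← Set.compl_Iic, prob_compl_eq_one_sub measurableSet_Iic, expMeasure_Iic, if_pos ht,
    ← ENNReal.ofReal_one, ← ENNReal.ofReal_sub _ (by simp [ht])]
  congr 1
  ring

/-- Memorylessness, without normalization: the mass of (t, t + a] is exp(-t)(1 - exp(-a)) for a ≥ 0.
Half-lines suffice to identify finite measures. -/
lemma expMeasure_shift {t : ℝ} (ht : 0 ≤ t) :
    ((expMeasure 1).restrict (Set.Ioi t)).map (fun x => x - t) =
      expMeasure 1 (Set.Ioi t) • expMeasure 1 := by
  have hm : Measurable fun x : ℝ => x - t := by fun_prop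
  have : IsFiniteMeasure (expMeasure 1 (Set.Ioi t) • expMeasure 1) :=
    Measure.smul_finite _ (measure_ne_top _ _)
  refine Measure.ext_of_Iic _ _ fun a => ?_
  rw [Measure.map_apply hm measurableSet_Iic,
    Measure.restrict_apply (hm measurableSet_Iic), Measure.smul_apply, smul_eq_mul]
  have hset : (fun x => x - t) ⁻¹' Set.Iic a ∩ Set.Ioi t = Set.Ioc t (t + a) := by
    ext x
    simp only [Set.mem_inter_iff, Set.mem_preimage, Set.mem_Iic, Set.mem_Ioi, Set.mem_Ioc]
    constructor
    · rintro ⟨h1, h2⟩; exact ⟨h2, by linarith⟩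
    · rintro ⟨h1, h2⟩; exact ⟨by linarith, h1⟩
  rw [hset, expMeasure_Ioi ht, expMeasure_Iic, ← ENNReal.ofReal_mul (Real.exp_pos _).le,
    ← measure_cdf (expMeasure 1), StieltjesFunction.measure_Ioc, cdf_expMeasure_eq one_pos,
    cdf_expMeasure_eq one_pos, if_pos ht]
  rcases le_or_gt 0 a with ha | ha
  · rw [if_pos ha, if_pos (by linarith)]
    congr 1
    rw [mul_sub, ← Real.exp_add]
    ring_nf
  · rw [if_neg (not_le.2 ha)]
    simp only [mul_zero, ENNReal.ofReal_zero, ENNReal.ofReal_eq_zero]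
    split_ifs
    · have : Real.exp (-(1 * t)) ≤ Real.exp (-(1 * (t + a))) :=
        Real.exp_le_exp.2 (by linarith)
      linarith
    · have : Real.exp (-(1 * t)) ≤ 1 := Real.exp_le_one_iff.2 (by linarith)
      linarith

lemma stepLaw_shift {t : ℝ} (ht : 0 ≤ t) :
    (stepLaw.restrict {x | t < x.1}).map (fun x => (x.1 - t, x.2)) =
      stepLaw {x | t < x.1} • stepLaw := by
  have hset : {x : ℝ × ℝ | t < x.1} = Set.Ioi t ×ˢ Set.univ := by ext; simp
  have hm : Measurable fun x : ℝ => x - t := by fun_prop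
  have hmap := Measure.map_prod_map ((expMeasure 1).restrict (Set.Ioi t))
    (volume.restrict (Set.Icc (0 : ℝ) 1)) hm measurable_id
  have hval : stepLaw (Set.Ioi t ×ˢ Set.univ) = expMeasure 1 (Set.Ioi t) := by
    rw [stepLaw, Measure.prod_prod, measure_univ, mul_one]
  rw [hset, hval, stepLaw, ← Measure.prod_restrict, Measure.restrict_univ]
  change Measure.map (Prod.map (fun x => x - t) id) _ = _
  rw [← hmap, expMeasure_shift ht, Measure.map_id, Measure.prod_smul_left]

/-! ### The Markov property -/

/-- Exactly the first `n` points of the path come before `t`. -/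
def HitAt (t : ℝ) (n : ℕ) (ω : ℕ → ℝ × ℝ) : Prop :=
  (∀ k < n, pathTime ω k ≤ t) ∧ t < pathTime ω n

/-- The path after `t`, when there are `n` points up to `t`. -/
def shiftAt (t : ℝ) (n : ℕ) (ω : ℕ → ℝ × ℝ) : ℕ → ℝ × ℝ
  | 0 => (pathTime ω n - t, (ω n).2)
  | k + 1 => ω (n + (k + 1))

/-- The first `n` points of the path, completed with `x`. -/
def truncAt (n : ℕ) (x : ℝ × ℝ) (ω : ℕ → ℝ × ℝ) : ℕ → ℝ × ℝ :=
  fun k => if k < n then ω k else x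

lemma measurableSet_hitAt (t : ℝ) (n : ℕ) : MeasurableSet {ω | HitAt t n ω} := by
  have : {ω | HitAt t n ω} =
      (⋂ k, ⋂ (_ : k < n), {ω | pathTime ω k ≤ t}) ∩ {ω | t < pathTime ω n} := by
    ext; simp [HitAt]
  rw [this]
  exact (MeasurableSet.iInter fun k => MeasurableSet.iInter fun _ =>
    measurableSet_le (measurable_pathTime k) measurable_const).inter
      (measurableSet_lt measurable_const (measurable_pathTime n))

@[fun_prop]
lemma measurable_shiftAt (t : ℝ) (n : ℕ) : Measurable (shiftAt t n) := by
  refine measurable_pi_lambda _ fun k => ?_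
  cases k with
  | zero => simp only [shiftAt]; fun_prop
  | succ k => exact measurable_pi_apply _

@[fun_prop]
lemma measurable_truncAt (n : ℕ) (x : ℝ × ℝ) : Measurable (truncAt n x) := by
  refine measurable_pi_lambda _ fun k => ?_
  unfold truncAt
  by_cases hk : k < n
  · simpa [hk] using measurable_pi_apply k
  · simp [hk]

lemma hitAt_succ_consPath {t : ℝ} {n : ℕ} {x : ℝ × ℝ} {ω : ℕ → ℝ × ℝ} :
    HitAt t (n + 1) (consPath x ω) ↔ x.1 ≤ t ∧ HitAt (t - x.1) n ω := by
  simp only [HitAt, pathTime_consPath_succ]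
  constructor
  · rintro ⟨h1, h2⟩
    refine ⟨by simpa [pathTime_consPath_zero] using h1 0 n.succ_pos, fun k hk => ?_, by linarith⟩
    have := h1 (k + 1) (by omega)
    rw [pathTime_consPath_succ] at this
    linarith
  · rintro ⟨h0, h1, h2⟩
    refine ⟨fun k hk => ?_, by linarith⟩
    cases k with
    | zero => simpa [pathTime_consPath_zero] using h0
    | succ k =>
      have := h1 k (by omega)
      rw [pathTime_consPath_succ]
      linarith

lemma shiftAt_succ_consPath (t : ℝ) (n : ℕ) (x : ℝ × ℝ) (ω : ℕ → ℝ × ℝ) :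
    shiftAt t (n + 1) (consPath x ω) = shiftAt (t - x.1) n ω := by
  funext k
  cases k with
  | zero =>
    simp only [shiftAt, pathTime_consPath_succ, consPath, Prod.mk.injEq, and_true]
    ring
  | succ k =>
    simp only [shiftAt]
    rw [show n + 1 + (k + 1) = n + (k + 1) + 1 by ring, consPath]

lemma truncAt_succ_consPath (n : ℕ) (y x : ℝ × ℝ) (ω : ℕ → ℝ × ℝ) :
    truncAt (n + 1) y (consPath x ω) = consPath x (truncAt n y ω) := by
  funext k
  cases k <;> simp [truncAt, consPath]

lemma pathLaw_apply {S : Set (ℕ → ℝ × ℝ)} (hS : MeasurableSet S) :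
    pathLaw S = ∫⁻ x, pathLaw {ω | consPath x ω ∈ S} ∂stepLaw := by
  conv_lhs => rw [← map_consPath]
  rw [Measure.map_apply measurable_consPath hS, Measure.prod_apply (measurable_consPath hS)]
  rfl

/-- The Markov property at time `t`, on the event that there are `n` points up to `t`. -/
lemma pathLaw_hitAt (n : ℕ) (y : ℝ × ℝ) {t : ℝ} (ht : 0 ≤ t) {B C : Set (ℕ → ℝ × ℝ)}
    (hB : MeasurableSet B) (hC : MeasurableSet C) :
    pathLaw {ω | HitAt t n ω ∧ truncAt n y ω ∈ B ∧ shiftAt t n ω ∈ C} =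
      pathLaw {ω | HitAt t n ω ∧ truncAt n y ω ∈ B} * pathLaw C := by
  induction n generalizing t B with
  -- No point up to t: the truncated path is the constant filler, and memorylessness of the first
  -- waiting time gives the claim.
  | zero =>
    have htrunc : ∀ ω, truncAt 0 y ω = fun _ => y := fun ω => by funext k; simp [truncAt]
    simp only [htrunc]
    by_cases hy : (fun _ => y) ∈ B
    swap
    · simp [hy]
    have hm : Measurable fun x : ℝ × ℝ => (x.1 - t, x.2) := by fun_prop
    have hset : MeasurableSet {x : ℝ × ℝ | t < x.1} :=
      measurableSet_lt measurable_const measurable_fst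
    have hpre : (fun a : (ℝ × ℝ) × (ℕ → ℝ × ℝ) => consPath a.1 a.2) ⁻¹'
        {ω | HitAt t 0 ω ∧ shiftAt t 0 ω ∈ C} =
        Prod.map (fun x : ℝ × ℝ => (x.1 - t, x.2)) id ⁻¹'
          ((fun a : (ℝ × ℝ) × (ℕ → ℝ × ℝ) => consPath a.1 a.2) ⁻¹' C) ∩
          ({x : ℝ × ℝ | t < x.1} ×ˢ Set.univ) := by
      ext ⟨x, ω⟩
      have hs : shiftAt t 0 (consPath x ω) = consPath (x.1 - t, x.2) ω := by
        funext k
        cases k with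
        | zero => simp [shiftAt, consPath, pathTime]
        | succ k => simp [shiftAt, consPath]
      simp [HitAt, hs, pathTime_consPath_zero, and_comm]
    have hpre' : (fun a : (ℝ × ℝ) × (ℕ → ℝ × ℝ) => consPath a.1 a.2) ⁻¹' {ω | HitAt t 0 ω} =
        {x : ℝ × ℝ | t < x.1} ×ˢ Set.univ := by
      ext ⟨x, ω⟩
      simp [HitAt, pathTime_consPath_zero]
    simp only [hy, true_and, and_true]
    have hmeas : MeasurableSet {ω | HitAt t 0 ω ∧ shiftAt t 0 ω ∈ C} :=
      (measurableSet_hitAt t 0).inter (measurable_shiftAt t 0 hC)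
    have hcons := measurable_consPath hC
    have h1 : pathLaw {ω | HitAt t 0 ω} = stepLaw {x | t < x.1} := by
      conv_lhs => rw [← map_consPath]
      rw [Measure.map_apply measurable_consPath (measurableSet_hitAt t 0), hpre',
        Measure.prod_prod, measure_univ, mul_one]
    rw [h1]
    conv_lhs => rw [← map_consPath]
    rw [Measure.map_apply measurable_consPath hmeas, hpre,
      ← Measure.restrict_apply ((hm.prodMap measurable_id) hcons), ← Measure.prod_restrict,
      Measure.restrict_univ, ← Measure.map_apply (hm.prodMap measurable_id) hcons,
      ← Measure.map_prod_map _ _ hm measurable_id, stepLaw_shift ht, Measure.map_id,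
      Measure.prod_smul_left, Measure.smul_apply, smul_eq_mul,
      ← Measure.map_apply measurable_consPath hC, map_consPath]
  -- Given the first point x, the rest of the path has n points up to t - x.1; hence the induction
  -- over all t and B.
  | succ n ih =>
    have hm1 : MeasurableSet {ω | HitAt t (n + 1) ω ∧ truncAt (n + 1) y ω ∈ B} :=
      (measurableSet_hitAt t _).inter (measurable_truncAt _ y hB)
    have hm2 : MeasurableSet
        {ω | HitAt t (n + 1) ω ∧ truncAt (n + 1) y ω ∈ B ∧ shiftAt t (n + 1) ω ∈ C} :=
      (measurableSet_hitAt t _).inter ((measurable_truncAt _ y hB).inter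
        (measurable_shiftAt t _ hC))
    have hmeas : Measurable fun x => pathLaw
        {ω | consPath x ω ∈ {ω | HitAt t (n + 1) ω ∧ truncAt (n + 1) y ω ∈ B}} :=
      measurable_measure_prodMk_left (measurable_consPath hm1)
    rw [pathLaw_apply hm1, pathLaw_apply hm2, ← lintegral_mul_const _ hmeas]
    refine lintegral_congr fun x => ?_
    simp only [Set.mem_ofPred_eq, hitAt_succ_consPath, shiftAt_succ_consPath,
      truncAt_succ_consPath]
    by_cases hx : x.1 ≤ t
    · simp only [hx, true_and]
      exact ih (sub_nonneg.2 hx) (B := {ω | consPath x ω ∈ B})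
        ((measurable_consPath.comp measurable_prodMk_left) hB)
    · simp [hx]

/-- The number of points up to time `t`. -/
noncomputable def numPoints (t : ℝ) (ω : ℕ → ℝ × ℝ) : ℕ := sInf {n | t < pathTime ω n}

/-- The path shifted by `t`. -/
noncomputable def shift (t : ℝ) (ω : ℕ → ℝ × ℝ) : ℕ → ℝ × ℝ := shiftAt t (numPoints t ω) ω

/-- The path up to time `t`. -/
noncomputable def trunc (t : ℝ) (ω : ℕ → ℝ × ℝ) : ℕ → ℝ × ℝ :=
  -- The filler waiting time t + 1 ensures that, on good paths, no point is added in (0, t].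
  truncAt (numPoints t ω) (t + 1, 0) ω

lemma HitAt.numPoints_eq {t : ℝ} {n : ℕ} {ω : ℕ → ℝ × ℝ} (h : HitAt t n ω) :
    numPoints t ω = n := by
  refine le_antisymm (Nat.sInf_le h.2) ?_
  by_contra! hlt
  exact (h.1 _ hlt).not_gt (Nat.sInf_mem (⟨n, h.2⟩ : {n | t < pathTime ω n}.Nonempty))

lemma hitAt_numPoints {t : ℝ} {ω : ℕ → ℝ × ℝ} (h : ∃ n, t < pathTime ω n) :
    HitAt t (numPoints t ω) ω :=
  ⟨fun _ hk => not_lt.1 (Nat.notMem_of_lt_sInf hk), Nat.sInf_mem h⟩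

lemma measurable_numPoints (t : ℝ) : Measurable (numPoints t) := by
  refine measurable_to_countable' fun n => ?_
  -- Paths that never exceed t are a separate case: there `numPoints` is `sInf ∅ = 0`.
  have hno : MeasurableSet {ω : ℕ → ℝ × ℝ | ∀ k, ¬ t < pathTime ω k} := by
    simp only [not_lt, Set.ofPred_forall]
    exact MeasurableSet.iInter fun k => measurableSet_le (measurable_pathTime k) measurable_const
  have : numPoints t ⁻¹' {n} =
      {ω | HitAt t n ω} ∪ ({ω | ∀ k, ¬ t < pathTime ω k} ∩ {_ω | n = 0}) := by
    ext ω
    simp only [Set.mem_preimage, Set.mem_singleton_iff, Set.mem_union, Set.mem_ofPred_eq,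
      Set.mem_inter_iff]
    constructor
    · rintro rfl
      by_cases h : ∃ k, t < pathTime ω k
      · exact Or.inl (hitAt_numPoints h)
      · push Not at h
        refine Or.inr ⟨fun k => not_lt.2 (h k), ?_⟩
        have : {n | t < pathTime ω n} = ∅ :=
          Set.eq_empty_iff_forall_notMem.2 fun k => not_lt.2 (h k)
        rw [numPoints, this, Nat.sInf_empty]
    · rintro (h | ⟨h, rfl⟩)
      · exact h.numPoints_eq
      · have : {n | t < pathTime ω n} = ∅ := Set.eq_empty_iff_forall_notMem.2 h
        rw [numPoints, this, Nat.sInf_empty]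
  rw [this]
  exact (measurableSet_hitAt t n).union (hno.inter (MeasurableSet.const _))

@[fun_prop]
lemma measurable_shift (t : ℝ) : Measurable (shift t) :=
  (measurable_from_prod_countable_right (f := fun a : ℕ × (ℕ → ℝ × ℝ) => shiftAt t a.1 a.2)
    fun n => measurable_shiftAt t n).comp ((measurable_numPoints t).prodMk measurable_id)

@[fun_prop]
lemma measurable_trunc (t : ℝ) : Measurable (trunc t) :=
  (measurable_from_prod_countable_right
    (f := fun a : ℕ × (ℕ → ℝ × ℝ) => truncAt a.1 (t + 1, 0) a.2)
    fun n => measurable_truncAt n _).comp ((measurable_numPoints t).prodMk measurable_id)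

lemma ae_stepLaw_of_fst {P : ℝ → Prop} (h : ∀ᵐ x ∂expMeasure 1, P x) :
    ∀ᵐ x ∂stepLaw, P x.1 := Measure.quasiMeasurePreserving_fst.ae h

lemma ae_stepLaw_of_snd {P : ℝ → Prop} (h : ∀ᵐ x ∂(volume.restrict (Set.Icc (0 : ℝ) 1)), P x) :
    ∀ᵐ x ∂stepLaw, P x.2 := Measure.quasiMeasurePreserving_snd.ae h

lemma ae_pathLaw {P : ℝ × ℝ → Prop} (h : ∀ᵐ x ∂stepLaw, P x) :
    ∀ᵐ ω ∂pathLaw, ∀ k, P (ω k) :=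
  ae_all_iff.2 fun k =>
    (measurePreserving_eval_infinitePi (fun _ => stepLaw) k).quasiMeasurePreserving.ae h

/-- The properties of paths that hold almost surely and are used below. -/
structure GoodPath (c : ℝ) (ω : ℕ → ℝ × ℝ) : Prop where
  pos : ∀ k, 0 < (ω k).1
  unbounded : ∀ t, ∃ n, t < pathTime ω n
  mark_ne : ∀ k, (ω k).2 ≠ c

/-- Second Borel–Cantelli lemma: these independent events have the same positive probability.
Infinitely many long waiting times prevent the points from accumulating. -/
lemma ae_frequently_one_lt : ∀ᵐ ω ∂pathLaw, ∃ᶠ k in Filter.atTop, 1 < (ω k).1 := by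
  have hset : MeasurableSet {x : ℝ × ℝ | 1 < x.1} :=
    measurableSet_lt measurable_const measurable_fst
  let s : ℕ → Set (ℕ → ℝ × ℝ) := fun k => {ω | 1 < (ω k).1}
  have hs : ∀ k, MeasurableSet (s k) := fun k =>
    (by fun_prop : Measurable fun ω : ℕ → ℝ × ℝ => ω k) hset
  have hval : ∀ k, pathLaw (s k) = stepLaw {x | 1 < x.1} := fun k =>
    (measurePreserving_eval_infinitePi (fun _ => stepLaw) k).measure_preimage
      hset.nullMeasurableSet
  have hpos : stepLaw {x : ℝ × ℝ | 1 < x.1} ≠ 0 := by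
    have : {x : ℝ × ℝ | 1 < x.1} = Set.Ioi 1 ×ˢ Set.univ := by ext; simp
    rw [this, stepLaw, Measure.prod_prod, measure_univ, mul_one, expMeasure_Ioi zero_le_one]
    simp [Real.exp_pos]
  have hind : iIndepSet s pathLaw := by
    rw [iIndepSet_iff_meas_biInter hs]
    intro F
    have : (⋂ k ∈ F, s k) = Set.pi F fun _ => {x : ℝ × ℝ | 1 < x.1} := by ext; simp [s]
    rw [this, pathLaw, Measure.infinitePi_pi _ fun _ _ => hset]
    exact Finset.prod_congr rfl fun k _ => (hval k).symm
  have h1 := measure_limsup_eq_one hs hind (by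
    simp only [hval]
    exact ENNReal.tsum_const_eq_top_of_ne_zero hpos)
  have h2 : ∀ᵐ ω ∂pathLaw, ω ∈ Filter.limsup s Filter.atTop :=
    (mem_ae_iff_prob_eq_one (MeasurableSet.measurableSet_limsup hs)).2 h1
  filter_upwards [h2] with ω hω
  exact Filter.mem_limsup_iff_frequently_mem.1 hω

lemma ae_goodPath (c : ℝ) : ∀ᵐ ω ∂pathLaw, GoodPath c ω := by
  have hpos : ∀ᵐ x ∂expMeasure 1, 0 < x := by
    rw [ae_iff]
    have : {x : ℝ | ¬ 0 < x} = Set.Iic 0 := by ext; simp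
    rw [this, expMeasure_Iic]
    simp
  have hne : ∀ᵐ x ∂(volume.restrict (Set.Icc (0 : ℝ) 1)), x ≠ c :=
    ae_restrict_of_ae (Measure.ae_ne volume c)
  filter_upwards [ae_pathLaw (ae_stepLaw_of_fst hpos), ae_pathLaw (ae_stepLaw_of_snd hne),
    ae_frequently_one_lt] with ω h1 h2 h3
  refine ⟨h1, fun t => ?_, h2⟩
  by_contra! hbdd
  have hsum : Summable fun k => (ω k).1 := by
    refine summable_of_sum_range_le (c := t) (fun k => (h1 k).le) fun n => ?_
    refine le_trans ?_ (hbdd n)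
    exact Finset.sum_le_sum_of_subset_of_nonneg (Finset.range_mono n.le_succ)
      fun k _ _ => (h1 k).le
  have hev : ∀ᶠ k in Filter.atTop, (ω k).1 < 1 :=
    hsum.tendsto_atTop_zero.eventually (gt_mem_nhds one_pos)
  obtain ⟨k, hk, hk'⟩ := (h3.and_eventually hev).exists
  exact lt_asymm hk hk'

/-- The Markov property: the path after `t` is independent of the path up to `t`, and it is again
a Poisson process. -/
theorem pathLaw_markov {t : ℝ} (ht : 0 ≤ t) {B C : Set (ℕ → ℝ × ℝ)} (hB : MeasurableSet B)
    (hC : MeasurableSet C) :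
    pathLaw (trunc t ⁻¹' B ∩ shift t ⁻¹' C) = pathLaw (trunc t ⁻¹' B) * pathLaw C := by
  -- Up to a null set the events `HitAt t n` form a partition; on each of them `trunc` and `shift`
  -- reduce to `truncAt` and `shiftAt` with n fixed.
  have hdec : ∀ S : Set (ℕ → ℝ × ℝ), MeasurableSet S →
      pathLaw S = ∑' n, pathLaw (S ∩ {ω | HitAt t n ω}) := by
    intro S hS
    rw [← measure_iUnion (fun n n' hn => ?_) fun n => hS.inter (measurableSet_hitAt t n)]
    · refine measure_congr ?_
      filter_upwards [ae_goodPath 0] with ω hω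
      refine propext ⟨fun h => ?_, fun h => ?_⟩
      · exact Set.mem_iUnion.2 ⟨_, h, hitAt_numPoints (hω.unbounded t)⟩
      · obtain ⟨n, hn⟩ := Set.mem_iUnion.1 h
        exact hn.1
    · refine Set.disjoint_left.2 fun ω h h' => hn ?_
      rw [← HitAt.numPoints_eq h.2, ← HitAt.numPoints_eq h'.2]
  rw [hdec _ ((measurable_trunc t hB).inter (measurable_shift t hC)),
    hdec _ (measurable_trunc t hB), ← ENNReal.tsum_mul_right]
  refine tsum_congr fun n => ?_
  convert pathLaw_hitAt n (t + 1, 0) ht hB hC using 2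
  · ext ω
    simp only [Set.mem_inter_iff, Set.mem_preimage, Set.mem_ofPred_eq]
    constructor
    · rintro ⟨⟨h1, h2⟩, h⟩
      rw [trunc, h.numPoints_eq] at h1
      rw [shift, h.numPoints_eq] at h2
      exact ⟨h, h1, h2⟩
    · rintro ⟨h, h1, h2⟩
      rw [trunc, shift, h.numPoints_eq]
      exact ⟨⟨h1, h2⟩, h⟩
  · congr 1
    ext ω
    simp only [Set.mem_inter_iff, Set.mem_preimage, Set.mem_ofPred_eq]
    constructor
    · rintro ⟨h1, h⟩
      rw [trunc, h.numPoints_eq] at h1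
      exact ⟨h, h1⟩
    · rintro ⟨h, h1⟩
      rw [trunc, h.numPoints_eq]
      exact ⟨h1, h⟩

end Paths

/-! ### Cutting a marked Poisson process into slabs -/

section Slabs

/-- The path in the `k`-th slab of length `Δ`. -/
noncomputable def slab (Δ : ℝ) (k : ℕ) (ω : ℕ → ℝ × ℝ) : ℕ → ℝ × ℝ :=
  trunc Δ ((shift Δ)^[k] ω)

@[fun_prop]
lemma measurable_slab (Δ : ℝ) (k : ℕ) : Measurable (slab Δ k) :=
  (measurable_trunc Δ).comp ((measurable_shift Δ).iterate k)

lemma slab_succ (Δ : ℝ) (k : ℕ) : slab Δ (k + 1) = slab Δ k ∘ shift Δ := by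
  funext ω
  simp [slab]

/-- The Markov property at Δ splits off slab 0. The other slabs are those of the shifted path, which
has the same law, so induction applies. -/
lemma pathLaw_iInter_slab {Δ : ℝ} (hΔ : 0 ≤ Δ) (n : ℕ) {B : ℕ → Set (ℕ → ℝ × ℝ)}
    (hB : ∀ k, MeasurableSet (B k)) :
    pathLaw (⋂ k ∈ Finset.range n, slab Δ k ⁻¹' B k) =
      ∏ k ∈ Finset.range n, pathLaw (trunc Δ ⁻¹' B k) := by
  induction n generalizing B with
  | zero => simp
  | succ n ih =>
    have hset : (⋂ k ∈ Finset.range (n + 1), slab Δ k ⁻¹' B k) =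
        trunc Δ ⁻¹' B 0 ∩ shift Δ ⁻¹' (⋂ k ∈ Finset.range n, slab Δ k ⁻¹' B (k + 1)) := by
      ext ω
      simp only [Set.mem_iInter, Finset.mem_range, Set.mem_inter_iff, Set.mem_preimage]
      constructor
      · intro h
        refine ⟨h 0 n.succ_pos, fun k hk => ?_⟩
        have := h (k + 1) (by omega)
        rwa [slab_succ] at this
      · rintro ⟨h0, h⟩ k hk
        cases k with
        | zero => exact h0
        | succ k =>
          rw [slab_succ]
          exact h k (by omega)
    rw [hset, pathLaw_markov hΔ (hB 0), ih fun k => hB (k + 1), Finset.prod_range_succ', mul_comm]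
    exact Finset.measurableSet_biInter _ fun k _ => measurable_slab Δ k (hB (k + 1))

/-- The restrictions of a marked Poisson process to disjoint slabs are independent. -/
theorem iIndepFun_slab {Δ : ℝ} (hΔ : 0 ≤ Δ) : iIndepFun (slab Δ) pathLaw := by
  classical
  -- Marginal law of one slab: the product formula with trivial events in the others.
  have hone : ∀ k {B : Set (ℕ → ℝ × ℝ)}, MeasurableSet B →
      pathLaw (slab Δ k ⁻¹' B) = pathLaw (trunc Δ ⁻¹' B) := by
    intro k B hB
    have := pathLaw_iInter_slab hΔ (k + 1) (B := fun j => if j = k then B else Set.univ)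
      (fun j => by split_ifs <;> simp [hB])
    rw [Finset.prod_eq_single_of_mem k (by simp) (fun j _ hj => by simp [hj])] at this
    simp only [if_true] at this
    rw [← this]
    congr 1
    ext ω
    simp only [Set.mem_preimage, Set.mem_iInter, Finset.mem_range]
    constructor
    · intro h j _
      by_cases hj : j = k
      · subst hj; simpa using h
      · simp [hj]
    · intro h
      simpa using h k (by omega)
  rw [iIndepFun_iff_measure_inter_preimage_eq_mul]
  intro S sets hsets
  obtain ⟨n, hn⟩ := S.exists_nat_subset_range
  have key := pathLaw_iInter_slab hΔ n (B := fun k => if k ∈ S then sets k else Set.univ)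
    (fun k => by
      split_ifs with hk
      · exact hsets k hk
      · exact MeasurableSet.univ)
  have h1 : (⋂ k ∈ Finset.range n, slab Δ k ⁻¹' (if k ∈ S then sets k else Set.univ)) =
      ⋂ k ∈ S, slab Δ k ⁻¹' sets k := by
    ext ω
    simp only [Set.mem_iInter, Set.mem_preimage]
    constructor
    · intro h k hk
      simpa [hk] using h k (hn hk)
    · intro h k _
      by_cases hk : k ∈ S
      · simpa [hk] using h k hk
      · simp [hk]
  rw [h1] at key
  rw [key, ← Finset.prod_subset hn fun k _ hk => by simp [hk]]
  refine Finset.prod_congr rfl fun k hk => ?_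
  rw [hone k (hsets k hk), if_pos hk]

end Slabs

/-! ### Grouping independent families -/

section Curry

variable {Ω ι κ 𝓧 : Type*} [MeasurableSpace Ω] [MeasurableSpace 𝓧] {μ : Measure Ω}

/-- Grouping the variables of an independent family yields an independent family. -/
lemma iIndepFun_curry {X : ι → κ → Ω → 𝓧} (mX : ∀ i j, Measurable (X i j))
    (h : iIndepFun (fun (p : ι × κ) ω => X p.1 p.2 ω) μ) :
    iIndepFun (fun i ω j => X i j ω) μ := by
  have := h.isProbabilityMeasure
  have : ∀ i j, IsProbabilityMeasure (μ.map (X i j)) := fun i j =>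
    Measure.isProbabilityMeasure_map (mX i j).aemeasurable
  have hlaw := h.map_fun_eq_infinitePi_map fun p : ι × κ => mX p.1 p.2
  rw [iIndepFun_iff_map_fun_eq_infinitePi_map
    fun i => measurable_pi_lambda _ fun j => mX i j]
  have hrow : ∀ i, μ.map (fun ω j => X i j ω) = Measure.infinitePi fun j => μ.map (X i j) :=
    fun i => iIndepFun.map_fun_eq_infinitePi_map (mX i)
      (h.precomp (g := fun j => (i, j)) fun _ _ hj => (Prod.mk.inj hj).2)
  simp only [hrow]
  rw [← Measure.infinitePi_map_curry fun i j => μ.map (X i j), ← hlaw,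
    Measure.map_map (by fun_prop) (by fun_prop)]
  rfl

end Curry

/-! ### Independence of the updates over edges and slabs -/

namespace RandomUpdates

variable {E Ω : Type*} [MeasurableSpace Ω] {μ : Measure Ω} (R : RandomUpdates E μ)

/-- The path of the waiting times and marks of the updates of `e`. -/
def path (e : E) (ω : Ω) : ℕ → ℝ × ℝ := fun k => (R.gap e k ω, R.mark e k ω)

lemma measurable_path (e : E) : Measurable (R.path e) :=
  measurable_pi_lambda _ fun k => (R.measurable_gap e k).prodMk (R.measurable_mark e k)

/-- The waiting times and the marks as one family of real random variables. -/
def coord (e : E) (a : ℕ × Bool) : Ω → ℝ := bif a.2 then R.gap e a.1 else R.mark e a.1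

lemma measurable_coord (e : E) (a : ℕ × Bool) : Measurable (R.coord e a) := by
  rcases a with ⟨k, _ | _⟩
  · exact R.measurable_mark e k
  · exact R.measurable_gap e k

/-- Reindexes `R.indep` with the edge first, the form required for grouping by edges and then by
points. -/
lemma iIndepFun_coord : iIndepFun (fun (z : E × ℕ × Bool) ω => R.coord z.1 z.2 ω) μ := by
  let g : E × ℕ × Bool → (E × ℕ) ⊕ (E × ℕ) := fun z =>
    bif z.2.2 then Sum.inl (z.1, z.2.1) else Sum.inr (z.1, z.2.1)
  have hg : g.Injective := by
    rintro ⟨e, k, _ | _⟩ ⟨e', k', _ | _⟩ h <;> simp_all [g]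
  refine (iIndepFun_congr fun z => ?_).1 (R.indep.precomp hg)
  rcases z with ⟨e, k, _ | _⟩ <;> exact Filter.EventuallyEq.rfl

theorem iIndepFun_path : iIndepFun R.path μ := by
  have h := iIndepFun_curry R.measurable_coord R.iIndepFun_coord
  exact h.comp (fun _ x k => (x (k, true), x (k, false))) fun _ => by fun_prop

theorem map_path (e : E) : μ.map (R.path e) = pathLaw := by
  have hcoord : iIndepFun (fun (a : ℕ × Bool) ω => R.coord e a ω) μ :=
    R.iIndepFun_coord.precomp (g := fun a => (e, a)) fun _ _ h => (Prod.mk.inj h).2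
  have hpair : iIndepFun (fun k ω => (R.gap e k ω, R.mark e k ω)) μ :=
    (iIndepFun_curry (X := fun k b => R.coord e (k, b)) (fun k b => R.measurable_coord e (k, b))
      hcoord).comp (fun _ x => (x true, x false)) fun _ => by fun_prop
  have := hpair.isProbabilityMeasure
  have hlaw := hpair.map_fun_eq_infinitePi_map fun k =>
    (R.measurable_gap e k).prodMk (R.measurable_mark e k)
  have hstep : ∀ k, μ.map (fun ω => (R.gap e k ω, R.mark e k ω)) = stepLaw := by
    intro k
    have hind : IndepFun (R.gap e k) (R.mark e k) μ :=
      R.indep.indepFun (i := Sum.inl (e, k)) (j := Sum.inr (e, k)) (by simp)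
    rw [(indepFun_iff_map_prod_eq_prod_map_map (R.measurable_gap e k).aemeasurable
      (R.measurable_mark e k).aemeasurable).1 hind, R.law_gap, R.law_mark, stepLaw]
  simp only [hstep] at hlaw
  exact hlaw

/-- The data of the updates in all the slabs of length `Δ`. -/
noncomputable def slabs (Δ : ℝ) (ω : Ω) (z : E × ℕ) : ℕ → ℝ × ℝ := slab Δ z.2 (R.path z.1 ω)

lemma measurable_slabs (Δ : ℝ) (z : E × ℕ) : Measurable fun ω => R.slabs Δ ω z :=
  (measurable_slab Δ z.2).comp (R.measurable_path z.1)

/-- The updates of the different edges in the different slabs are independent. -/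
theorem iIndepFun_slabs {Δ : ℝ} (hΔ : 0 ≤ Δ) : iIndepFun (fun z ω => R.slabs Δ ω z) μ := by
  refine iIndepFun_uncurry' (X := fun e k ω => slab Δ k (R.path e ω))
    (fun e k => (measurable_slab Δ k).comp (R.measurable_path e)) ?_ fun e => ?_
  · exact R.iIndepFun_path.comp (fun _ x k => slab Δ k x) fun _ => by fun_prop
  · rw [iIndepFun_iff_measure_inter_preimage_eq_mul]
    intro S sets hsets
    have h := (iIndepFun_slab hΔ).measure_inter_preimage_eq_mul S hsets
    rw [← R.map_path e, Measure.map_apply (R.measurable_path e) (Finset.measurableSet_biInter _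
      fun k hk => measurable_slab Δ k (hsets k hk)), Set.preimage_iInter₂] at h
    refine h.trans (Finset.prod_congr rfl fun k hk => ?_)
    rw [Measure.map_apply (R.measurable_path e) (measurable_slab Δ k (hsets k hk))]
    rfl

lemma ae_goodPath_path [Countable E] (c : ℝ) : ∀ᵐ ω ∂μ, ∀ e, GoodPath c (R.path e ω) := by
  refine ae_all_iff.2 fun e => ?_
  have := ae_goodPath c
  rw [← R.map_path e] at this
  exact ae_of_ae_map (R.measurable_path e).aemeasurable this

end RandomUpdates

/-! ### Recovering the points of a path from its slabs -/

section Points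

/-- The points of a path with their marks. -/
def points (ω : ℕ → ℝ × ℝ) : Set (ℝ × ℝ) := {a | ∃ k, a = (pathTime ω k, (ω k).2)}

lemma pathTime_succ (ω : ℕ → ℝ × ℝ) (k : ℕ) :
    pathTime ω (k + 1) = pathTime ω k + (ω (k + 1)).1 := Finset.sum_range_succ _ _

variable {c : ℝ} {ω : ℕ → ℝ × ℝ}

lemma GoodPath.strictMono (h : GoodPath c ω) : StrictMono (pathTime ω) :=
  strictMono_nat_of_lt_succ fun k => by rw [pathTime_succ]; linarith [h.pos (k + 1)]

lemma GoodPath.lt_numPoints_iff (h : GoodPath c ω) {t : ℝ} {k : ℕ} :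
    k < numPoints t ω ↔ pathTime ω k ≤ t := by
  have hit := hitAt_numPoints (h.unbounded t)
  refine ⟨hit.1 k, fun hk => ?_⟩
  by_contra! hle
  exact (hit.2.trans_le (h.strictMono.monotone hle)).not_ge hk

lemma pathTime_shift (t : ℝ) (ω : ℕ → ℝ × ℝ) (j : ℕ) :
    pathTime (shift t ω) j = pathTime ω (numPoints t ω + j) - t := by
  induction j with
  | zero => simp [pathTime, shift, shiftAt]
  | succ j ih =>
    rw [pathTime_succ, ih, ← add_assoc, pathTime_succ]
    simp only [shift, shiftAt, ← add_assoc]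
    ring

lemma shift_snd (t : ℝ) (ω : ℕ → ℝ × ℝ) (j : ℕ) :
    (shift t ω j).2 = (ω (numPoints t ω + j)).2 := by
  cases j <;> rfl

lemma GoodPath.shift (h : GoodPath c ω) (t : ℝ) : GoodPath c (shift t ω) where
  pos k := by
    cases k with
    | zero => exact sub_pos.2 (hitAt_numPoints (h.unbounded t)).2
    | succ k => exact h.pos _
  unbounded s := by
    obtain ⟨n, hn⟩ := h.unbounded (s + t)
    refine ⟨n, ?_⟩
    have := h.strictMono.monotone (Nat.le_add_left n (numPoints t ω))
    rw [pathTime_shift]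
    linarith
  mark_ne k := by rw [shift_snd]; exact h.mark_ne _

lemma GoodPath.mem_points_shift (h : GoodPath c ω) {t s U : ℝ} (hs : 0 < s) :
    (s, U) ∈ points (FK.shift t ω) ↔ (t + s, U) ∈ points ω := by
  constructor
  · rintro ⟨j, hj⟩
    obtain ⟨h1, h2⟩ := Prod.mk.inj hj
    rw [pathTime_shift] at h1
    rw [shift_snd] at h2
    exact ⟨_, Prod.ext (by simp only; linarith) h2⟩
  · rintro ⟨k, hk⟩
    obtain ⟨h1, h2⟩ := Prod.mk.inj hk
    have hle : numPoints t ω ≤ k := by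
      by_contra! hlt
      have := h.lt_numPoints_iff.1 hlt
      linarith
    obtain ⟨j, rfl⟩ := Nat.exists_eq_add_of_le hle
    refine ⟨j, Prod.ext ?_ ?_⟩
    · rw [pathTime_shift]; simp only; linarith
    · rw [shift_snd]; exact h2

lemma GoodPath.iterate_shift (h : GoodPath c ω) (t : ℝ) (k : ℕ) :
    GoodPath c ((FK.shift t)^[k] ω) := by
  induction k with
  | zero => exact h
  | succ k ih => rw [Function.iterate_succ_apply']; exact ih.shift t

lemma GoodPath.mem_points_iterate_shift (h : GoodPath c ω) {t s U : ℝ} (ht : 0 ≤ t) (hs : 0 < s)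
    (k : ℕ) : (s, U) ∈ points ((FK.shift t)^[k] ω) ↔ (k * t + s, U) ∈ points ω := by
  induction k generalizing s with
  | zero => simp
  | succ k ih =>
    rw [Function.iterate_succ_apply', (h.iterate_shift t k).mem_points_shift hs, ih (by linarith)]
    push_cast
    rw [show (k : ℝ) * t + (t + s) = (k + 1) * t + s by ring]

lemma GoodPath.mem_points_trunc (h : GoodPath c ω) {t s U : ℝ} (hs : 0 < s) (hst : s ≤ t) :
    (s, U) ∈ points (trunc t ω) ↔ (s, U) ∈ points ω := by
  have hlt : ∀ k < numPoints t ω, trunc t ω k = ω k := fun k hk => by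
    simp [trunc, truncAt, hk]
  have htime : ∀ k < numPoints t ω, pathTime (trunc t ω) k = pathTime ω k := fun k hk =>
    Finset.sum_congr rfl fun j hj => by
      rw [hlt j (by have := Finset.mem_range.1 hj; omega)]
  constructor
  · rintro ⟨k, hk⟩
    obtain ⟨h1, h2⟩ := Prod.mk.inj hk
    by_cases hkN : k < numPoints t ω
    · rw [htime k hkN] at h1
      rw [hlt k hkN] at h2
      exact ⟨k, Prod.ext h1 h2⟩
    · exfalso
      have hnn : ∀ j ∈ Finset.range (k + 1), 0 ≤ (trunc t ω j).1 := fun j _ => by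
        by_cases hj : j < numPoints t ω
        · rw [hlt j hj]; exact (h.pos j).le
        · simp only [trunc, truncAt, hj, if_false]; linarith
      have := Finset.single_le_sum hnn (Finset.self_mem_range_succ k)
      have hval : (trunc t ω k).1 = t + 1 := by simp [trunc, truncAt, hkN]
      rw [hval] at this
      change t + 1 ≤ pathTime (trunc t ω) k at this
      linarith
  · rintro ⟨k, hk⟩
    obtain ⟨h1, h2⟩ := Prod.mk.inj hk
    have hkN : k < numPoints t ω := h.lt_numPoints_iff.2 (by linarith)
    exact ⟨k, Prod.ext (by rw [htime k hkN]; exact h1) (by rw [hlt k hkN]; exact h2)⟩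

lemma GoodPath.mem_points_slab (h : GoodPath c ω) {Δ s U : ℝ} (hs : 0 < s) (hst : s ≤ Δ)
    (k : ℕ) : (s, U) ∈ points (slab Δ k ω) ↔ (k * Δ + s, U) ∈ points ω := by
  rw [slab, (h.iterate_shift Δ k).mem_points_trunc hs hst,
    h.mem_points_iterate_shift (by linarith) hs]

/-- The time of the `j`-th candidate update of `e` recorded by the slab data `z`; it is `0` if
there is no such update. -/
noncomputable def slabTime {E : Type*} (p : ℝ) (z : E × ℕ → ℕ → ℝ × ℝ) (e : E) (j : ℕ × ℕ) : ℝ :=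
  -- Points outside (0, Δ], such as those of the filler, are discarded, as they would fall in later
  -- slabs. The dummy time 0 lies in no interval (τ_k, τ_{k+1}].
  if 0 < pathTime (z (e, j.1)) j.2 ∧ pathTime (z (e, j.1)) j.2 ≤ (Real.sqrt p)⁻¹ then
    tau p j.1 + pathTime (z (e, j.1)) j.2 else 0

/-- The realization of the update sequence recorded by the slab data `z`. -/
def ofSlabs {E : Type*} (p : ℝ) (z : E × ℕ → ℕ → ℝ × ℝ) (e : E) : Set (ℝ × ℝ) :=
  {a | ∃ j : ℕ × ℕ, a = (slabTime p z e j, (z (e, j.1) j.2).2)}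

lemma tau_succ (p : ℝ) (k : ℕ) : tau p (k + 1) = tau p k + (Real.sqrt p)⁻¹ := by
  simp only [tau]; push_cast; ring

/-- Genuine times recorded for slab l lie in (τ_l, τ_{l+1}], so slab k sees only the entry (e, k) of
z. -/
lemma mem_updIn_ofSlabs {E : Type*} {p : ℝ} {z : E × ℕ → ℕ → ℝ × ℝ} {e : E} {k : ℕ}
    {a : ℝ × ℝ} : a ∈ updIn (ofSlabs p z) (tau p k) (tau p (k + 1)) e ↔
      (tau p k < a.1 ∧ a.1 ≤ tau p (k + 1)) ∧ (a.1 - tau p k, a.2) ∈ points (z (e, k)) := by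
  constructor
  · rintro ⟨⟨⟨l, j⟩, rfl⟩, h1, h2⟩
    refine ⟨⟨h1, h2⟩, j, ?_⟩
    simp only [slabTime] at h1 h2 ⊢
    split_ifs at h1 h2 ⊢ with h
    swap
    · exact absurd h1 (tau_nonneg p k).not_gt
    have hlk : l = k := by
      rw [tau_succ] at h2
      by_contra hne
      rcases Nat.lt_or_gt_of_ne hne with hlt | hgt
      · have := tau_mono p (Nat.succ_le_of_lt hlt)
        rw [Nat.succ_eq_add_one, tau_succ] at this
        linarith [h.2]
      · have := tau_mono p (Nat.succ_le_of_lt hgt)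
        rw [Nat.succ_eq_add_one, tau_succ] at this
        linarith [h.1]
    subst hlk
    simp
  · rintro ⟨⟨h1, h2⟩, j, hj⟩
    obtain ⟨hj1, hj2⟩ := Prod.mk.inj hj
    rw [tau_succ] at h2
    refine ⟨⟨(k, j), Prod.ext ?_ hj2⟩, h1, by rwa [tau_succ]⟩
    simp only [slabTime]
    rw [← hj1, if_pos ⟨by linarith, by linarith⟩]
    ring

lemma agreeAt_ofSlabs {E : Type*} {p : ℝ} {z z' : E × ℕ → ℕ → ℝ × ℝ} {k : ℕ} {e : E}
    (h : z (e, k) = z' (e, k)) : AgreeAt p (ofSlabs p z) (ofSlabs p z') k e := by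
  ext a
  rw [mem_updIn_ofSlabs, mem_updIn_ofSlabs, h]

/-- Cutting a good path loses no update: a point at τ_{k+1} exactly belongs to slab k in both
descriptions. -/
lemma RandomUpdates.agreeAt_slabs {E Ω : Type*} [MeasurableSpace Ω] {μ : Measure Ω}
    (R : RandomUpdates E μ) {p : ℝ} {ω : Ω} {e : E} (h : GoodPath c (R.path e ω)) (k : ℕ) :
    AgreeAt p (R.upd ω) (ofSlabs p (R.slabs (Real.sqrt p)⁻¹ ω)) k e := by
  ext ⟨s, U⟩
  rw [mem_updIn_ofSlabs]
  change _ ∈ points (R.path e ω) ∧ tau p k < s ∧ s ≤ tau p (k + 1) ↔ _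
  rw [and_comm]
  refine and_congr_right fun ⟨h1, h2⟩ => ?_
  rw [tau_succ] at h2
  rw [RandomUpdates.slabs, h.mem_points_slab (by simpa using h1) (by simp only; linarith)]
  simp [tau]

lemma exists_slab (p : ℝ) {i : ℕ} {t : ℝ} (ht : 0 < t) (hti : t ≤ tau p i) :
    ∃ k < i, tau p k < t ∧ t ≤ tau p (k + 1) := by
  induction i with
  | zero => simp [tau] at hti; linarith
  | succ i ih =>
    rcases le_or_gt t (tau p i) with h | h
    · obtain ⟨k, hk, h⟩ := ih h
      exact ⟨k, by omega, h⟩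
    · exact ⟨i, by omega, h, hti⟩

end Points

/-! ### Dependence of the state on past updates only -/

section Congruence

variable {V : Type*} {G : SimpleGraph V} {p q : ℝ} {upd upd' : G.edgeSet → Set (ℝ × ℝ)}

/-- The state at time `t` depends only on the updates up to time `t`. -/
lemma fkState_congr {t : ℝ}
    (h : ∀ e, ∀ a : ℝ × ℝ, 0 < a.1 → a.1 ≤ t → (a ∈ upd e ↔ a ∈ upd' e)) (x₀ : Set G.edgeSet) :
    fkState p q upd x₀ t = fkState p q upd' x₀ t := by
  have htimes : updateTimes upd t = updateTimes upd' t := by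
    ext s
    refine and_congr_right fun h0 => and_congr_right fun h1 => ?_
    exact exists_congr fun e => exists_congr fun U => h e (s, U) h0 h1
  have happly : ∀ s ∈ updateTimes upd t, ∀ S,
      applyUpdates p q upd S s = applyUpdates p q upd' S s := by
    rintro s ⟨h0, h1, -⟩ S
    ext e
    have hs : ∀ U, (s, U) ∈ upd e ↔ (s, U) ∈ upd' e := fun U => h e (s, U) h0 h1
    simp only [applyUpdates, Set.mem_ofPred_eq, hs]
  by_cases hfin : (updateTimes upd t).Finite
  · have hfin' : (updateTimes upd' t).Finite := htimes ▸ hfin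
    have hF : hfin'.toFinset = hfin.toFinset := by ext; simp [htimes]
    rw [fkState_of_finite hfin, fkState_of_finite hfin', hF]
    refine List.foldl_ext _ _ _ fun S s hs => happly s ?_ S
    simpa using hs
  · have hfin' : ¬ (updateTimes upd' t).Finite := htimes ▸ hfin
    rw [fkState, dif_neg hfin, fkState, dif_neg hfin']

lemma fkState_congr_of_agreeAt {i : ℕ} (h : ∀ k < i, ∀ e, AgreeAt p upd upd' k e) {t : ℝ}
    (ht : t ≤ tau p i) (x₀ : Set G.edgeSet) :
    fkState p q upd x₀ t = fkState p q upd' x₀ t := by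
  refine fkState_congr (fun e a h0 h1 => ?_) x₀
  obtain ⟨k, hk, hk'⟩ := exists_slab p h0 (h1.trans ht)
  have := Set.ext_iff.1 (h k hk e) a
  exact ⟨fun ha => (this.1 ⟨ha, hk'⟩).1, fun ha => (this.2 ⟨ha, hk'⟩).1⟩

end Congruence

/-! ### Measurability -/

section Measurability

variable {V : Type*} {G : SimpleGraph V} {p q : ℝ}

/-- The realization of the update sequence given by families of times and marks. -/
def ofFamily {E ι : Type*} (T U : E → ι → ℝ) (e : E) : Set (ℝ × ℝ) :=
  {a | ∃ j, a = (T e j, U e j)}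

lemma mem_ofFamily {E ι : Type*} {T U : E → ι → ℝ} {e : E} {t u : ℝ} :
    (t, u) ∈ ofFamily T U e ↔ ∃ j, T e j = t ∧ U e j = u := by
  simp [ofFamily, eq_comm]

/-- The list `l` enumerates the update times in `(0, t]` in chronological order. -/
def Enumerates {E ι : Type*} (T : E → ι → ℝ) (t : ℝ) (l : List (E × ι)) : Prop :=
  l.Pairwise (fun c c' => T c.1 c.2 < T c'.1 c'.2) ∧
    (∀ c ∈ l, 0 < T c.1 c.2 ∧ T c.1 c.2 ≤ t) ∧
      ∀ c : E × ι, 0 < T c.1 c.2 → T c.1 c.2 ≤ t → ∃ c' ∈ l, T c'.1 c'.2 = T c.1 c.2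

/-- For a fixed list l the dynamics is a finite fold, measurable in T and U. As there are countably
many lists, this makes the state measurable. -/
lemma fkState_of_enumerates {ι : Type*} {T U : G.edgeSet → ι → ℝ} {t : ℝ} {l : List (G.edgeSet × ι)}
    (h : Enumerates T t l) (x₀ : Set G.edgeSet) :
    fkState p q (ofFamily T U) x₀ t =
      (l.map fun c => T c.1 c.2).foldl (applyUpdates p q (ofFamily T U)) x₀ := by
  obtain ⟨hsort, hmem, hall⟩ := h
  have htimes : updateTimes (ofFamily T U) t = {s | s ∈ l.map fun c => T c.1 c.2} := by
    ext s
    simp only [updateTimes, Set.mem_ofPred_eq, mem_ofFamily, List.mem_map]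
    constructor
    · rintro ⟨h0, h1, e, _, j, rfl, -⟩
      exact hall (e, j) h0 h1
    · rintro ⟨c, hc, rfl⟩
      exact ⟨(hmem c hc).1, (hmem c hc).2, c.1, _, c.2, rfl, rfl⟩
  have hfin : (updateTimes (ofFamily T U) t).Finite := by
    rw [htimes]; exact List.finite_toSet _
  have hpw : (l.map fun c => T c.1 c.2).Pairwise (· < ·) := List.pairwise_map.2 hsort
  rw [fkState, dif_pos hfin]
  congr 1
  refine List.Perm.eq_of_pairwise' (r := (· ≤ ·)) (Finset.pairwise_sort _ _)
    (hpw.imp fun h => h.le) ?_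
  refine (List.perm_ext_iff_of_nodup (Finset.sort_nodup _ _) (hpw.imp fun h => h.ne)).2 ?_
  intro s
  rw [Finset.mem_sort, Set.Finite.mem_toFinset, htimes]
  rfl

lemma exists_enumerates {ι : Type*} {T U : G.edgeSet → ι → ℝ} {t : ℝ}
    (h : (updateTimes (ofFamily T U) t).Finite) : ∃ l, Enumerates T t l := by
  have hrange : ∀ s ∈ h.toFinset.sort (· ≤ ·),
      s ∈ Set.range fun c : G.edgeSet × ι => T c.1 c.2 := by
    intro s hs
    rw [Finset.mem_sort, Set.Finite.mem_toFinset] at hs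
    obtain ⟨-, -, e, u, hu⟩ := hs
    obtain ⟨j, hj, -⟩ := mem_ofFamily.1 hu
    exact ⟨(e, j), hj⟩
  obtain ⟨l, hl⟩ : h.toFinset.sort (· ≤ ·) ∈
      Set.range (List.map fun c : G.edgeSet × ι => T c.1 c.2) := by
    rw [Set.range_list_map]; exact hrange
  have hmem : ∀ s, s ∈ l.map (fun c => T c.1 c.2) ↔ s ∈ updateTimes (ofFamily T U) t := by
    intro s; rw [hl, Finset.mem_sort, Set.Finite.mem_toFinset]
  refine ⟨l, ?_, fun c hc => ?_, fun c h0 h1 => ?_⟩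
  · refine List.pairwise_map (R := (· < ·)).1 ?_
    rw [hl]
    exact (Finset.sortedLT_sort _).pairwise
  · have := (hmem _).1 (List.mem_map_of_mem hc)
    exact ⟨this.1, this.2.1⟩
  · have := (hmem _).2 ⟨h0, h1, c.1, _, mem_ofFamily.2 ⟨c.2, rfl, rfl⟩⟩
    exact List.mem_map.1 this

variable {Z ι : Type*} [MeasurableSpace Z] [Countable ι]
  {T U : Z → G.edgeSet → ι → ℝ}

lemma measurable_eq_fun {Z : Type*} [MeasurableSpace Z] {f g : Z → ℝ} (hf : Measurable f)
    (hg : Measurable g) : Measurable fun z => f z = g z :=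
  measurableSet_setOfPred.1 (measurableSet_eq_fun hf hg)

section FiniteGraph

variable [Finite V]

lemma measurable_applyUpdates (hT : ∀ e j, Measurable fun z => T z e j)
    (hU : ∀ e j, Measurable fun z => U z e j) {S : Z → Set G.edgeSet} (hS : Measurable S)
    {t : Z → ℝ} (ht : Measurable t) :
    Measurable fun z => applyUpdates p q (ofFamily (T z) (U z)) (S z) (t z) := by
  rw [measurable_set_iff]
  intro e
  -- The space of configurations is finite and discrete, so any function of S is measurable.
  have hcut : Measurable fun z => IsCutEdge (S z) e :=
    (Measurable.of_discrete (f := fun s : Set G.edgeSet => IsCutEdge s e)).comp hS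
  have hmem : ∀ z, e ∈ applyUpdates p q (ofFamily (T z) (U z)) (S z) (t z) ↔
      (∃ j, T z e j = t z ∧ 1 - p ≤ U z e j ∧
        (U z e j < 1 - p + pStar p q ∨ ¬ IsCutEdge (S z) e)) ∨
      ((∀ j, T z e j ≠ t z) ∧ e ∈ S z) := by
    intro z
    simp only [applyUpdates, Set.mem_ofPred_eq, mem_ofFamily]
    refine or_congr ⟨?_, ?_⟩ (and_congr_left fun _ => ⟨?_, ?_⟩)
    · rintro ⟨_, ⟨j, hj, rfl⟩, h⟩
      exact ⟨j, hj, h⟩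
    · rintro ⟨j, hj, h⟩
      exact ⟨_, ⟨j, hj, rfl⟩, h⟩
    · exact fun h j hj => h _ ⟨j, hj, rfl⟩
    · rintro h _ ⟨j, hj, -⟩
      exact h j hj
  simp only [hmem]
  have hSe := measurable_set_iff.1 hS e
  refine ((Measurable.exists fun j => ?_).or ((Measurable.forall fun j => ?_).and hSe))
  · exact (measurable_eq_fun (hT e j) ht).and ((measurable_const.le' (hU e j)).and
      (((hU e j).lt measurable_const).or hcut.not))
  · exact (measurable_eq_fun (hT e j) ht).not

lemma measurable_foldl_applyUpdates (hT : ∀ e j, Measurable fun z => T z e j)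
    (hU : ∀ e j, Measurable fun z => U z e j) (l : List (G.edgeSet × ι))
    {S : Z → Set G.edgeSet} (hS : Measurable S) :
    Measurable fun z => (l.map fun c => T z c.1 c.2).foldl
      (applyUpdates p q (ofFamily (T z) (U z))) (S z) := by
  induction l generalizing S with
  | nil => simpa using hS
  | cons c l ih =>
    simp only [List.map_cons, List.foldl_cons]
    exact ih (measurable_applyUpdates hT hU hS (hT c.1 c.2))

lemma measurableSet_enumerates (hT : ∀ e j, Measurable fun z => T z e j) (t : ℝ)
    (l : List (G.edgeSet × ι)) : MeasurableSet {z | Enumerates (T z) t l} := by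
  have hT' : ∀ c : G.edgeSet × ι, Measurable fun z => T z c.1 c.2 := fun c => hT c.1 c.2
  refine Measurable.setOf (Measurable.and ?_ (Measurable.and ?_ ?_))
  · simp only [List.pairwise_iff_getElem]
    exact Measurable.forall fun a => Measurable.forall fun b => Measurable.forall fun _ =>
      Measurable.forall fun _ => Measurable.forall fun _ => (hT' _).lt (hT' _)
  · exact Measurable.forall fun c => Measurable.imp measurable_const
      ((measurable_const.lt (hT' c)).and ((hT' c).le' measurable_const))
  · refine Measurable.forall fun c => Measurable.imp (measurable_const.lt (hT' c)) (Measurable.imp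
      ((hT' c).le' measurable_const) (Measurable.exists fun c' => ?_))
    exact Measurable.and measurable_const (measurable_eq_fun (hT' c') (hT' c))

/-- The state of the dynamics at a given time is a measurable function of the updates. -/
theorem measurable_fkState (hT : ∀ e j, Measurable fun z => T z e j)
    (hU : ∀ e j, Measurable fun z => U z e j) (x₀ : Set G.edgeSet) (t : ℝ) :
    Measurable fun z => fkState p q (ofFamily (T z) (U z)) x₀ t := by
  refine measurable_to_countable' fun s => ?_
  -- Countable decomposition over the lists; if none enumerates, there are infinitely many update
  -- times and the state is the default x₀.
  have hset : (fun z => fkState p q (ofFamily (T z) (U z)) x₀ t) ⁻¹' {s} =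
      (⋃ l : List (G.edgeSet × ι), {z | Enumerates (T z) t l} ∩
        (fun z => (l.map fun c => T z c.1 c.2).foldl
          (applyUpdates p q (ofFamily (T z) (U z))) x₀) ⁻¹' {s}) ∪
      ((⋃ l : List (G.edgeSet × ι), {z | Enumerates (T z) t l})ᶜ ∩ {_z | x₀ = s}) := by
    ext z
    simp only [Set.mem_preimage, Set.mem_singleton_iff, Set.mem_union, Set.mem_iUnion,
      Set.mem_inter_iff, Set.mem_ofPred_eq, Set.mem_compl_iff]
    by_cases h : ∃ l, Enumerates (T z) t l
    · obtain ⟨l, hl⟩ := h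
      rw [fkState_of_enumerates hl]
      constructor
      · exact fun h => Or.inl ⟨l, hl, h⟩
      · rintro (⟨l', hl', h⟩ | ⟨h, -⟩)
        · rw [← h, ← fkState_of_enumerates hl, fkState_of_enumerates hl']
        · exact absurd ⟨l, hl⟩ h
    · have hfin : ¬ (updateTimes (ofFamily (T z) (U z)) t).Finite :=
        fun hfin => h (exists_enumerates hfin)
      rw [fkState, dif_neg hfin]
      constructor
      · exact fun hs => Or.inr ⟨h, hs⟩
      · rintro (⟨l, hl, -⟩ | ⟨-, hs⟩)
        · exact absurd ⟨l, hl⟩ h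
        · exact hs
  rw [hset]
  refine MeasurableSet.union (MeasurableSet.iUnion fun l => ?_) (MeasurableSet.inter ?_ ?_)
  · exact (measurableSet_enumerates hT t l).inter
      (measurable_foldl_applyUpdates hT hU l measurable_const (measurableSet_singleton s))
  · exact (MeasurableSet.iUnion fun l => measurableSet_enumerates hT t l).compl
  · exact MeasurableSet.const _

end FiniteGraph

lemma measurable_mem_slab {f : Z → ℝ} (hf : Measurable f) (s t : ℝ) :
    Measurable fun z => s < f z ∧ f z ≤ t :=
  (measurable_const.lt hf).and (hf.le' measurable_const)

lemma measurable_nonUpdate (hT : ∀ e j, Measurable fun z => T z e j) (k : ℕ) :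
    Measurable fun z => nonUpdate p (ofFamily (T z) (U z)) k := by
  rw [measurable_set_iff]
  intro e
  have hmem : ∀ z, e ∈ nonUpdate p (ofFamily (T z) (U z)) k ↔
      ∀ j, ¬ (tau p k < T z e j ∧ T z e j ≤ tau p (k + 1)) := by
    intro z
    simp only [nonUpdate, Set.mem_ofPred_eq, Set.eq_empty_iff_forall_notMem]
    constructor
    · exact fun h j hj => h (T z e j, U z e j) ⟨⟨j, rfl⟩, hj⟩
    · rintro h _ ⟨⟨j, rfl⟩, hj⟩
      exact h j hj
  simp only [hmem]
  exact Measurable.forall fun j => (measurable_mem_slab (hT e j) _ _).not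

lemma measurable_nonOblivious (hT : ∀ e j, Measurable fun z => T z e j)
    (hU : ∀ e j, Measurable fun z => U z e j) (k : ℕ) :
    Measurable fun z => nonOblivious p q (ofFamily (T z) (U z)) k := by
  rw [measurable_set_iff]
  intro e
  have hmem : ∀ z, e ∈ nonOblivious p q (ofFamily (T z) (U z)) k ↔
      ∃ j, (tau p k < T z e j ∧ T z e j ≤ tau p (k + 1)) ∧
        (∀ j', ¬ (tau p k < T z e j' ∧ T z e j' ≤ tau p (k + 1)) ∨ T z e j' ≤ T z e j) ∧
          ¬ U z e j < 1 - p + pStar p q := by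
    intro z
    constructor
    · rintro ⟨_, ⟨⟨⟨j, rfl⟩, hj⟩, hlast⟩, hobl⟩
      exact ⟨j, hj, fun j' => or_iff_not_imp_left.2 fun hj' =>
        hlast (T z e j', U z e j') ⟨⟨j', rfl⟩, not_not.1 hj'⟩, hobl⟩
    · rintro ⟨j, hj, hlast, hobl⟩
      refine ⟨_, ⟨⟨⟨j, rfl⟩, hj⟩, ?_⟩, hobl⟩
      rintro _ ⟨⟨j', rfl⟩, hj'⟩
      exact (hlast j').resolve_left (not_not.2 hj')
  simp only [hmem]
  exact Measurable.exists fun j => (measurable_mem_slab (hT e j) _ _).and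
    ((Measurable.forall fun j' => (measurable_mem_slab (hT e j') _ _).not.or
      ((hT e j').le' (hT e j))).and ((hU e j).lt measurable_const).not)

lemma measurable_env (hT : ∀ e j, Measurable fun z => T z e j)
    (hU : ∀ e j, Measurable fun z => U z e j) (k : ℕ) :
    Measurable fun z => env p (ofFamily (T z) (U z)) k := by
  rw [measurable_set_iff]
  intro e
  have hmem : ∀ z, e ∈ env p (ofFamily (T z) (U z)) k ↔
      (∃ j, (tau p k < T z e j ∧ T z e j ≤ tau p (k + 1)) ∧ 1 - p < U z e j) ∨
        e ∈ nonUpdate p (ofFamily (T z) (U z)) k := by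
    intro z
    rw [env, Set.mem_union, mem_enlargedEmpty]
    refine or_congr_left ⟨?_, ?_⟩
    · rintro ⟨_, ⟨⟨j, rfl⟩, hj⟩, h⟩
      exact ⟨j, hj, h⟩
    · rintro ⟨j, hj, h⟩
      exact ⟨_, ⟨⟨j, rfl⟩, hj⟩, h⟩
  simp only [hmem]
  exact (Measurable.exists fun j => (measurable_mem_slab (hT e j) _ _).and
    (measurable_const.lt (hU e j))).or (measurable_set_iff.1 (measurable_nonUpdate hT k) e)

section FiniteGraph

variable [Finite V]

lemma measurable_spread (hT : ∀ e j, Measurable fun z => T z e j)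
    (hU : ∀ e j, Measurable fun z => U z e j) (k : ℕ) {W : Z → Set G.edgeSet}
    (hW : Measurable W) :
    Measurable fun z => spread p q (ofFamily (T z) (U z)) k (W z) := by
  let Φ : Set G.edgeSet × Set G.edgeSet × Set G.edgeSet × Set G.edgeSet → Set G.edgeSet :=
    fun a => ⋃ w ∈ a.1 ∩ a.2.1, connBar w (a.2.2.1 ∪ a.2.2.2)
  exact (Measurable.of_discrete (f := Φ)).comp (hW.prodMk
    ((measurable_nonOblivious (p := p) (q := q) hT hU k).prodMk
      ((measurable_env (p := p) hT hU (k - 1)).prodMk (measurable_env (p := p) hT hU k))))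

lemma measurable_historyBack (hT : ∀ e j, Measurable fun z => T z e j)
    (hU : ∀ e j, Measurable fun z => U z e j) (m : ℕ) (e : G.edgeSet) (k : ℕ) :
    Measurable fun z => historyBack p q (ofFamily (T z) (U z)) m e k := by
  induction k with
  | zero => exact measurable_const
  | succ k ih =>
    let Φ : Set G.edgeSet × Set G.edgeSet × Set G.edgeSet → Set G.edgeSet :=
      fun a => (a.1 ∩ a.2.1) ∪ a.2.2
    exact (Measurable.of_discrete (f := Φ)).comp (ih.prodMk
      ((measurable_nonUpdate (p := p) (U := U) hT (m - (k + 1))).prodMk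
        (measurable_spread (p := p) (q := q) hT hU (m - (k + 1)) ih)))

/-- The event that some histories are prescribed is measurable. -/
theorem measurableSet_historyDiagram (hT : ∀ e j, Measurable fun z => T z e j)
    (hU : ∀ e j, Measurable fun z => U z e j) (m : ℕ) (H : HistoryDiagram G.edgeSet)
    (A : Set G.edgeSet) :
    MeasurableSet {z | ∀ e ∈ A,
      (historyDiagram p q (ofFamily (T z) (U z)) m).at_ e = H.at_ e ∧
        (historyDiagram p q (ofFamily (T z) (U z)) m).mid e = H.mid e} := by
  have hat : ∀ e k, Measurable fun z =>
      (historyDiagram p q (ofFamily (T z) (U z)) m).at_ e k := by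
    intro e k
    exact (Measurable.of_discrete
      (f := fun s : Set G.edgeSet => {w | 1 ≤ k ∧ k ≤ m ∧ w ∈ s})).comp
        (measurable_historyBack hT hU m e (m - k))
  have hmid : ∀ e k, Measurable fun z =>
      (historyDiagram p q (ofFamily (T z) (U z)) m).mid e k := by
    intro e k
    have h := measurable_historyBack (p := p) (q := q) hT hU m e (m - (k + 1))
    exact (Measurable.of_discrete
      (f := fun s : Set G.edgeSet × Set G.edgeSet =>
        {w | 1 ≤ k ∧ k + 1 ≤ m ∧ w ∈ s.1 ∪ s.2})).comp
        (h.prodMk (measurable_spread (p := p) (q := q) hT hU k h))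
  simp only [funext_iff]
  exact Measurable.setOf (Measurable.forall fun e => Measurable.imp measurable_const
    ((Measurable.forall fun k => (hat e k).eq_const _).and
      (Measurable.forall fun k => (hmid e k).eq_const _)))

end FiniteGraph

end Measurability

/-! ### Measurability in the slab data -/

section SlabData

variable {V : Type*} {G : SimpleGraph V} {p q : ℝ}

lemma measurable_slabTime (e : G.edgeSet) (j : ℕ × ℕ) :
    Measurable fun z : G.edgeSet × ℕ → ℕ → ℝ × ℝ => slabTime p z e j := by
  have h : Measurable fun z : G.edgeSet × ℕ → ℕ → ℝ × ℝ => pathTime (z (e, j.1)) j.2 :=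
    (measurable_pathTime j.2).comp (measurable_pi_apply _)
  exact Measurable.ite ((measurableSet_lt measurable_const h).inter
    (measurableSet_le h measurable_const)) (measurable_const.add h) measurable_const

lemma measurable_slabMark (e : G.edgeSet) (j : ℕ × ℕ) :
    Measurable fun z : G.edgeSet × ℕ → ℕ → ℝ × ℝ => (z (e, j.1) j.2).2 :=
  measurable_snd.comp ((measurable_pi_apply _).comp (measurable_pi_apply _))

lemma measurable_fkState_ofSlabs [Finite V] (x₀ : Set G.edgeSet) (t : ℝ) :
    Measurable fun z : G.edgeSet × ℕ → ℕ → ℝ × ℝ => fkState p q (ofSlabs p z) x₀ t :=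
  measurable_fkState measurable_slabTime measurable_slabMark x₀ t

lemma measurableSet_historyDiagram_ofSlabs [Finite V] (m : ℕ) (H : HistoryDiagram G.edgeSet)
    (A : Set G.edgeSet) :
    MeasurableSet {z : G.edgeSet × ℕ → ℕ → ℝ × ℝ | ∀ e ∈ A,
      (historyDiagram p q (ofSlabs p z) m).at_ e = H.at_ e ∧
        (historyDiagram p q (ofSlabs p z) m).mid e = H.mid e} :=
  measurableSet_historyDiagram measurable_slabTime measurable_slabMark m H A

end SlabData

/-! ### Independence -/

section Independence

variable {Ω α β γ : Type*} [MeasurableSpace Ω] [MeasurableSpace α] [MeasurableSpace β]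
  [MeasurableSpace γ] {μ : Measure Ω}

/-- If `X` is independent of `(Y, Z)` and `Y` is independent of `Z`, then `Y` is independent of
`(X, Z)`. -/
lemma indepFun_prodMk_of_indepFun [IsProbabilityMeasure μ] {X : Ω → α} {Y : Ω → β} {Z : Ω → γ}
    (hX : Measurable X) (hY : Measurable Y) (hZ : Measurable Z)
    (h : IndepFun X (fun ω => (Y ω, Z ω)) μ) (hYZ : IndepFun Y Z μ) :
    IndepFun Y (fun ω => (X ω, Z ω)) μ := by
  have hXZ : IndepFun X Z μ := h.comp measurable_id measurable_snd
  have := Measure.isProbabilityMeasure_map (μ := μ) hX.aemeasurable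
  have := Measure.isProbabilityMeasure_map (μ := μ) hY.aemeasurable
  have := Measure.isProbabilityMeasure_map (μ := μ) hZ.aemeasurable
  rw [indepFun_iff_map_prod_eq_prod_map_map hX.aemeasurable (hY.prodMk hZ).aemeasurable,
    (indepFun_iff_map_prod_eq_prod_map_map hY.aemeasurable hZ.aemeasurable).1 hYZ] at h
  rw [indepFun_iff_map_prod_eq_prod_map_map hY.aemeasurable (hX.prodMk hZ).aemeasurable,
    (indepFun_iff_map_prod_eq_prod_map_map hX.aemeasurable hZ.aemeasurable).1 hXZ]
  refine Measure.ext_prod₃_iff.2 fun {s t u} hs ht hu => ?_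
  rw [Measure.prod_prod, Measure.prod_prod,
    Measure.map_apply (hY.prodMk (hX.prodMk hZ)) (hs.prod (ht.prod hu))]
  have hset : (fun ω => (Y ω, X ω, Z ω)) ⁻¹' s ×ˢ t ×ˢ u =
      (fun ω => (X ω, Y ω, Z ω)) ⁻¹' t ×ˢ s ×ˢ u := by
    ext ω
    simp only [Set.mem_preimage, Set.mem_prod]
    tauto
  rw [hset, ← Measure.map_apply (hX.prodMk (hY.prodMk hZ)) (ht.prod (hs.prod hu)), h,
    Measure.prod_prod, Measure.prod_prod]
  ring

/-- Conditioning on an event of the form `{a ∈ SA} ∩ {b ∈ SB}` preserves the independence of `a`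
and `b`. -/
lemma indepFun_cond_inter [IsFiniteMeasure μ] {a : Ω → α} {b : Ω → β} (ha : Measurable a)
    (hb : Measurable b) (h : IndepFun a b μ) {SA : Set α} {SB : Set β} (hSA : MeasurableSet SA)
    (hSB : MeasurableSet SB) : IndepFun a b (cond μ (a ⁻¹' SA ∩ b ⁻¹' SB)) := by
  rw [indepFun_iff_measure_inter_preimage_eq_mul]
  intro s t hs ht
  have hE : MeasurableSet (a ⁻¹' SA ∩ b ⁻¹' SB) := (ha hSA).inter (hb hSB)
  have hprod : ∀ {s' : Set α} {t' : Set β}, MeasurableSet s' → MeasurableSet t' →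
      μ (a ⁻¹' s' ∩ b ⁻¹' t') = μ (a ⁻¹' s') * μ (b ⁻¹' t') := fun hs' ht' =>
    h.measure_inter_preimage_eq_mul _ _ hs' ht'
  have h1 : a ⁻¹' SA ∩ b ⁻¹' SB ∩ (a ⁻¹' s ∩ b ⁻¹' t) =
      a ⁻¹' (SA ∩ s) ∩ b ⁻¹' (SB ∩ t) := by
    ext; simp only [Set.mem_inter_iff, Set.mem_preimage]; tauto
  have h2 : a ⁻¹' SA ∩ b ⁻¹' SB ∩ a ⁻¹' s = a ⁻¹' (SA ∩ s) ∩ b ⁻¹' SB := by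
    ext; simp only [Set.mem_inter_iff, Set.mem_preimage]; tauto
  have h3 : a ⁻¹' SA ∩ b ⁻¹' SB ∩ b ⁻¹' t = a ⁻¹' SA ∩ b ⁻¹' (SB ∩ t) := by
    ext; simp only [Set.mem_inter_iff, Set.mem_preimage]; tauto
  rw [cond_apply hE, cond_apply hE, cond_apply hE, h1, h2, h3, hprod (hSA.inter hs) (hSB.inter ht),
    hprod (hSA.inter hs) hSB, hprod hSA (hSB.inter ht), hprod hSA hSB]
  have hle1 : μ (a ⁻¹' (SA ∩ s)) ≤ μ (a ⁻¹' SA) := measure_mono fun _ hω => hω.1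
  have hle2 : μ (b ⁻¹' (SB ∩ t)) ≤ μ (b ⁻¹' SB) := measure_mono fun _ hω => hω.1
  generalize μ (a ⁻¹' (SA ∩ s)) = x' at *
  generalize μ (b ⁻¹' (SB ∩ t)) = y' at *
  have hx : μ (a ⁻¹' SA) ≠ ⊤ := measure_ne_top _ _
  have hy : μ (b ⁻¹' SB) ≠ ⊤ := measure_ne_top _ _
  generalize μ (a ⁻¹' SA) = x at *
  generalize μ (b ⁻¹' SB) = y at *
  by_cases hx0 : x = 0
  · subst hx0
    simp [nonpos_iff_eq_zero.1 hle1]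
  by_cases hy0 : y = 0
  · subst hy0
    simp [nonpos_iff_eq_zero.1 hle2]
  have hxy : (x * y)⁻¹ * (x * y) = 1 :=
    ENNReal.inv_mul_cancel (mul_ne_zero hx0 hy0) (ENNReal.mul_ne_top hx hy)
  calc (x * y)⁻¹ * (x' * y') = (x * y)⁻¹ * (x' * y') * ((x * y)⁻¹ * (x * y)) := by
        rw [hxy, mul_one]
    _ = (x * y)⁻¹ * (x' * y) * ((x * y)⁻¹ * (x * y')) := by ring

/-- A criterion for conditional independence: up to null sets, the event is a product event for
two independent variables, and on this event `f` is a function of the first variable and `g` of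
the second one. -/
lemma indepFun_cond_of_indepFun {δ ε : Type*} [MeasurableSpace δ] [MeasurableSpace ε]
    [IsFiniteMeasure μ] {a : Ω → α} {b : Ω → β} (ha : Measurable a) (hb : Measurable b)
    (h : IndepFun a b μ) {SA : Set α} {SB : Set β} (hSA : MeasurableSet SA)
    (hSB : MeasurableSet SB) {S : Set Ω} (hS : ∀ᵐ ω ∂μ, ω ∈ S ↔ a ω ∈ SA ∧ b ω ∈ SB)
    {f : Ω → δ} {g : Ω → ε} {F : α → δ} {Ψ : β → ε} (hF : Measurable F) (hΨ : Measurable Ψ)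
    (hf : ∀ᵐ ω ∂μ, ω ∈ S → f ω = F (a ω)) (hg : ∀ᵐ ω ∂μ, ω ∈ S → g ω = Ψ (b ω)) :
    IndepFun f g (cond μ S) := by
  -- S is not assumed measurable, but `cond μ S` depends on S only up to null sets.
  have hSE : S =ᵐ[μ] (a ⁻¹' SA ∩ b ⁻¹' SB : Set Ω) := by
    filter_upwards [hS] with ω hω
    exact propext hω
  have hcond : cond μ S = cond μ (a ⁻¹' SA ∩ b ⁻¹' SB) := by
    rw [ProbabilityTheory.cond, ProbabilityTheory.cond, measure_congr hSE, Measure.restrict_congr_set hSE]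
  have hE : MeasurableSet (a ⁻¹' SA ∩ b ⁻¹' SB) := (ha hSA).inter (hb hSB)
  have hlift : ∀ {P : Ω → Prop}, (∀ᵐ ω ∂μ, ω ∈ S → P ω) →
      ∀ᵐ ω ∂(cond μ (a ⁻¹' SA ∩ b ⁻¹' SB)), P ω := by
    intro P hP
    refine Measure.ae_smul_measure ?_ _
    rw [ae_restrict_iff' hE]
    filter_upwards [hP, hS] with ω h1 h2 h3
    exact h1 (h2.2 h3)
  rw [hcond]
  have hind := (indepFun_cond_inter ha hb h hSA hSB).comp hF hΨ
  refine hind.congr ?_ ?_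
  · filter_upwards [hlift hf] with ω hω using hω.symm
  · filter_upwards [hlift hg] with ω hω using hω.symm

end Independence

/-! ### Information percolation clusters -/

section Clusters

variable {V : Type*} {G : SimpleGraph V} {p q : ℝ}

/-- A common edge of the two histories would join e to a member of A in the cluster graph. -/
lemma HistoryDiagram.IsCluster.disjoint_mid {E : Type*} {H : HistoryDiagram E} {A : Set E}
    (hA : H.IsCluster A) {e : E} (he : e ∉ A) {k : ℕ} {f : E} (hf : f ∈ H.mid e k) :
    f ∉ H.midSet A k := by
  intro hfA
  obtain ⟨e', he', hfe'⟩ := Set.mem_iUnion₂.1 hfA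
  obtain ⟨C, rfl⟩ := hA
  rw [SimpleGraph.ConnectedComponent.mem_supp_iff] at he he'
  refine he ?_
  rw [← he']
  refine SimpleGraph.ConnectedComponent.sound (SimpleGraph.Adj.reachable ?_)
  rw [HistoryDiagram.clusterGraph, SimpleGraph.fromRel_adj]
  refine ⟨?_, Or.inl ⟨k, Or.inr ⟨f, hf, hfe'⟩⟩⟩
  rintro rfl
  exact he he'

/-- The histories of the edges of `A` under `upd` are those of `H`. -/
def HasHistory (p q : ℝ) (upd : G.edgeSet → Set (ℝ × ℝ)) (m : ℕ) (H : HistoryDiagram G.edgeSet)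
    (A : Set G.edgeSet) : Prop :=
  ∀ e ∈ A, (historyDiagram p q upd m).at_ e = H.at_ e ∧
    (historyDiagram p q upd m).mid e = H.mid e

/-- For a cluster that has died out, the two conditions will be governed by disjoint sets of
updates. -/
lemma historyDiagram_eq_iff {upd : G.edgeSet → Set (ℝ × ℝ)} {m : ℕ}
    {H : HistoryDiagram G.edgeSet} (A : Set G.edgeSet) :
    historyDiagram p q upd m = H ↔ HasHistory p q upd m H A ∧ HasHistory p q upd m H Aᶜ := by
  constructor
  · rintro rfl
    exact ⟨fun _ _ => ⟨rfl, rfl⟩, fun _ _ => ⟨rfl, rfl⟩⟩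
  · rintro ⟨h1, h2⟩
    have h : ∀ e, _ := fun e => (em (e ∈ A)).elim (h1 e) (h2 e)
    exact HistoryDiagram.ext (funext fun e => (h e).1) (funext fun e => (h e).2)

/-- The edges and slabs that determine the histories of the edges of `A` down to `τ_i`. -/
def clusterRegion (H : HistoryDiagram G.edgeSet) (A : Set G.edgeSet) (i : ℕ) :
    Set (G.edgeSet × ℕ) := {c | i ≤ c.2 ∧ c.1 ∈ H.midSet A c.2}

variable {upd upd' : G.edgeSet → Set (ℝ × ℝ)} {m i : ℕ} {H : HistoryDiagram G.edgeSet}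
  {A : Set G.edgeSet}

/-- The histories of a cluster that dies out before `τ_i` depend only on the updates in its
region. -/
lemma HasHistory.congr_of_region (hp₀ : 0 < p) (hp₁ : p < 1) (hq : 1 < q) (hi : 1 ≤ i)
    (him : i + 1 ≤ m) (hAi : H.atSet A i = ∅)
    (hagree : ∀ k < m, ∀ f, (f, k) ∈ clusterRegion H A i → AgreeAt p upd upd' k f)
    (h : HasHistory p q upd m H A) : HasHistory p q upd' m H A := by
  intro e he
  -- Nothing before slab i matters: slab i - 1 would be inspected only on the spread in slab i,
  -- which is contained in 𝓗_A(τ_i) = ∅.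
  have hi0 : ∀ k ≤ i, (historyDiagram p q upd m).at_ e k = ∅ := by
    intro k hk
    refine historyDiagram_eq_empty_of_le him ?_ hk
    rw [(h e he).1]
    exact Set.subset_eq_empty (Set.subset_biUnion_of_mem (u := fun e => H.at_ e i) he) hAi
  have hmidH : ∀ k, (historyDiagram p q upd m).mid e k ⊆ H.midSet A k := by
    intro k
    rw [(h e he).2]
    exact Set.subset_biUnion_of_mem (u := fun e => H.mid e k) he
  rw [← (h e he).1, ← (h e he).2]
  refine historyDiagram_congr hp₀ hp₁ hq (D := fun k => {f | (f, k) ∈ clusterRegion H A i})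
    (fun k hk f hf => hagree k hk f hf) (fun k hk hkm f hf => ?_) (fun k hk hkm f hf => ?_)
  · refine ⟨?_, hmidH k hf⟩
    by_contra! hki
    rw [historyDiagram_mid hk hkm, hi0 (k + 1) hki] at hf
    simp [spread] at hf
  · have hik : i < k := by
      by_contra! hki
      rw [hi0 k hki] at hf
      exact hf
    refine ⟨show i ≤ k - 1 by omega, hmidH (k - 1) ?_⟩
    have := historyDiagram_at_subset_mid (p := p) (q := q) (upd := upd) (m := m) (k := k - 1)
      (by omega) (by omega) e
    rw [Nat.sub_add_cancel hk] at this
    exact this hf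

/-- The histories outside a cluster depend only on the updates outside its region. -/
lemma HasHistory.congr_of_compl_region (hp₀ : 0 < p) (hp₁ : p < 1) (hq : 1 < q) (hi : 1 ≤ i)
    (hA : H.IsCluster A)
    (hagree : ∀ k < m, ∀ f, (f, k) ∉ clusterRegion H A i → AgreeAt p upd upd' k f)
    (h : HasHistory p q upd m H Aᶜ) : HasHistory p q upd' m H Aᶜ := by
  intro e he
  have hmidH : ∀ k, ∀ f ∈ (historyDiagram p q upd m).mid e k, f ∉ H.midSet A k := by
    intro k f hf
    rw [(h e he).2] at hf
    exact hA.disjoint_mid he hf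
  rw [← (h e he).1, ← (h e he).2]
  refine historyDiagram_congr hp₀ hp₁ hq (D := fun k => {f | (f, k) ∉ clusterRegion H A i})
    (fun k hk f hf => hagree k hk f hf) (fun k hk hkm f hf hf' => hmidH k f hf hf'.2)
    (fun k hk hkm f hf hf' => ?_)
  -- As i ≥ 1, this gives k ≥ 2, so that 𝓗_e(τ_k) ⊆ 𝓗_e(τ_{k-1/2}).
  have hik : i ≤ k - 1 := hf'.1
  refine hmidH (k - 1) f ?_ hf'.2
  have := historyDiagram_at_subset_mid (p := p) (q := q) (upd := upd) (m := m) (k := k - 1)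
    (by omega) (by omega) e
  rw [Nat.sub_add_cancel hk] at this
  exact this hf

end Clusters

/-! ### The random update sequence in a region -/

section Mask

variable {E : Type*}

open Classical in
/-- The slab data `z` restricted to the edges and slabs in `I`. -/
noncomputable def mask (I : Set (E × ℕ)) (z : E × ℕ → ℕ → ℝ × ℝ) : E × ℕ → ℕ → ℝ × ℝ :=
  -- The zero path has all its points at time 0, hence records no update in the slab.
  fun c => if c ∈ I then z c else 0

lemma mask_of_mem {I : Set (E × ℕ)} {z : E × ℕ → ℕ → ℝ × ℝ} {c : E × ℕ} (h : c ∈ I) :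
    mask I z c = z c := if_pos h

lemma measurable_mask (I : Set (E × ℕ)) : Measurable (mask I) := by
  refine measurable_pi_lambda _ fun c => ?_
  by_cases h : c ∈ I
  · simpa [mask, h] using measurable_pi_apply c
  · simp [mask, h]

lemma updIn_ofSlabs_mask_of_notMem {p : ℝ} {I : Set (E × ℕ)} {z : E × ℕ → ℕ → ℝ × ℝ} {e : E}
    {k : ℕ} (h : (e, k) ∉ I) :
    updIn (ofSlabs p (mask I z)) (tau p k) (tau p (k + 1)) e = ∅ := by
  refine Set.eq_empty_iff_forall_notMem.2 fun a ha => ?_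
  rw [mem_updIn_ofSlabs] at ha
  obtain ⟨⟨h1, -⟩, j, hj⟩ := ha
  have := (Prod.mk.inj hj).1
  simp only [mask, h, if_false, pathTime, Pi.zero_apply, Prod.fst_zero, Finset.sum_const_zero]
    at this
  linarith

variable {Ω : Type*} [MeasurableSpace Ω] {μ : Measure Ω} (R : RandomUpdates E μ)

lemma RandomUpdates.agreeAt_mask {p c : ℝ} {ω : Ω} {e : E} (h : GoodPath c (R.path e ω))
    {I : Set (E × ℕ)} {k : ℕ} (hI : (e, k) ∈ I) :
    AgreeAt p (R.upd ω) (ofSlabs p (mask I (R.slabs (Real.sqrt p)⁻¹ ω))) k e :=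
  (R.agreeAt_slabs h k).trans (agreeAt_ofSlabs (mask_of_mem hI).symm)

/-- The slab data on disjoint finite sets of edges and slabs are independent. -/
lemma RandomUpdates.indepFun_mask {Δ : ℝ} (hΔ : 0 ≤ Δ) {I J : Set (E × ℕ)} (hI : I.Finite)
    (hJ : J.Finite) (hIJ : Disjoint I J) :
    IndepFun (fun ω => mask I (R.slabs Δ ω)) (fun ω => mask J (R.slabs Δ ω)) μ := by
  classical
  have h := (R.iIndepFun_slabs hΔ).indepFun_finset hI.toFinset hJ.toFinset
    (by rwa [Set.Finite.disjoint_toFinset]) (R.measurable_slabs Δ)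
  have hext : ∀ {K : Set (E × ℕ)} (hK : K.Finite), Measurable
      fun (x : (c : hK.toFinset) → ℕ → ℝ × ℝ) (c : E × ℕ) =>
        if hc : c ∈ K then x ⟨c, hK.mem_toFinset.2 hc⟩ else 0 := by
    intro K hK
    refine measurable_pi_lambda _ fun c => ?_
    by_cases hc : c ∈ K
    · simpa [hc] using measurable_pi_apply _
    · simp [hc]
  have h' := h.comp (hext hI) (hext hJ)
  have hmask : ∀ {K : Set (E × ℕ)} (hK : K.Finite), (fun ω => mask K (R.slabs Δ ω)) =
      (fun (x : (c : hK.toFinset) → ℕ → ℝ × ℝ) (c : E × ℕ) =>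
        if hc : c ∈ K then x ⟨c, hK.mem_toFinset.2 hc⟩ else 0) ∘
          fun ω (c : hK.toFinset) => R.slabs Δ ω c := by
    intro K hK
    funext ω c
    by_cases hc : c ∈ K <;> simp [mask, hc]
  rw [hmask hI, hmask hJ]
  exact h'

lemma RandomUpdates.measurable_slabs' (Δ : ℝ) : Measurable (R.slabs Δ) :=
  measurable_pi_lambda _ fun z => R.measurable_slabs Δ z

lemma RandomUpdates.IndepOf.indepFun_slabs {R : RandomUpdates E μ} {α : Type*}
    [MeasurableSpace α] {X : Ω → α} (h : R.IndepOf X) (Δ : ℝ) : IndepFun X (R.slabs Δ) μ := by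
  have hm : Measurable fun (x : E × ℕ → ℝ × ℝ) (z : E × ℕ) => slab Δ z.2 fun k => x (z.1, k) :=
    measurable_pi_lambda _ fun z => (measurable_slab Δ z.2).comp
      (measurable_pi_lambda _ fun k => measurable_pi_apply _)
  exact IndepFun.comp h measurable_id hm

end Mask

/-! ### Conditional independence for a cluster that dies out -/

section Random

variable {V : Type*} [Finite V] {G : SimpleGraph V} {p q : ℝ} {Ω : Type*} [MeasurableSpace Ω]
  {μ : Measure Ω} (R : RandomUpdates G.edgeSet μ)

lemma RandomUpdates.regular_upd {ω : Ω} (h : ∀ e, GoodPath (1 - p) (R.path e ω)) :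
    Regular p (R.upd ω) where
  finite t := by
    have hsub : updateTimes (R.upd ω) t ⊆
        ⋃ e, pathTime (R.path e ω) '' Set.Iio (numPoints t (R.path e ω)) := by
      rintro s ⟨-, hst, e, U, k, hk⟩
      have hs : s = pathTime (R.path e ω) k := (Prod.mk.inj hk).1
      exact Set.mem_iUnion.2 ⟨e, k, (h e).lt_numPoints_iff.2 (hs ▸ hst), hs.symm⟩
    exact (Set.finite_iUnion fun e => (Set.finite_Iio _).image _).subset hsub
  mark_ne := by
    rintro e _ ⟨k, rfl⟩
    exact (h e).mark_ne k

/-- If the history of a cluster dies out at `τ_i`, the configuration on it at `τ_{i+1}` is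
conditionally independent of the past of `τ_i`. -/
theorem RandomUpdates.indepFun_cond [IsProbabilityMeasure μ] (hp₀ : 0 < p) (hp₁ : p < 1)
    (hq : 1 < q) {m i : ℕ} (hi : 1 ≤ i) (him : i + 1 ≤ m) {H : HistoryDiagram G.edgeSet}
    {A : Set G.edgeSet} (hA : H.IsCluster A) (hAi : H.atSet A i = ∅)
    {X₀ : Ω → Set G.edgeSet} (hX₀ : Measurable X₀) (hind : R.IndepOf X₀) :
    IndepFun
      (fun ω => fkState p q (R.upd ω) (X₀ ω) (tau p (i + 1)) ∩ H.atSet A (i + 1))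
      (fun ω (s : Set.Icc (0 : ℝ) (tau p i)) => fkState p q (R.upd ω) (X₀ ω) s)
      (cond μ {ω | historyDiagram p q (R.upd ω) m = H}) := by
  set Δ := (Real.sqrt p)⁻¹
  have hΔ : 0 ≤ Δ := inv_nonneg.2 (Real.sqrt_nonneg p)
  -- I carries the updates deciding the histories of A, and J the others up to τ_m. The subset I₀ of
  -- I drives the configuration on the cluster during slab i.
  let I : Set (G.edgeSet × ℕ) := {c | c.2 < m ∧ c ∈ clusterRegion H A i}
  let J : Set (G.edgeSet × ℕ) := {c | c.2 < m ∧ c ∉ clusterRegion H A i}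
  let I₀ : Set (G.edgeSet × ℕ) := {c | c.2 = i ∧ c.1 ∈ H.midSet A i}
  have hfin : ({c : G.edgeSet × ℕ | c.2 < m}).Finite :=
    (Set.finite_univ.prod (Set.finite_Iio m)).subset fun c hc => ⟨trivial, hc⟩
  have hI : I.Finite := hfin.subset fun c hc => hc.1
  have hJ : J.Finite := hfin.subset fun c hc => hc.1
  have hIJ : Disjoint I J := Set.disjoint_left.2 fun c hc hc' => hc'.2 hc.2
  let a : Ω → G.edgeSet × ℕ → ℕ → ℝ × ℝ := fun ω => mask I (R.slabs Δ ω)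
  let b : Ω → G.edgeSet × ℕ → ℕ → ℝ × ℝ := fun ω => mask J (R.slabs Δ ω)
  have ha : Measurable a := (measurable_mask I).comp (R.measurable_slabs' Δ)
  have hb : Measurable b := (measurable_mask J).comp (R.measurable_slabs' Δ)
  -- X₀ is grouped with b because the past up to τ_i is a function of both.
  have hab : IndepFun a (fun ω => (X₀ ω, b ω)) μ :=
    indepFun_prodMk_of_indepFun hX₀ ha hb
      ((hind.indepFun_slabs Δ).comp measurable_id
        ((measurable_mask I).prodMk (measurable_mask J))) (R.indepFun_mask hΔ hI hJ hIJ)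
  have hgood := R.ae_goodPath_path (1 - p)
  have hagreeA : ∀ {ω}, (∀ e, GoodPath (1 - p) (R.path e ω)) → ∀ k < m, ∀ f,
      (f, k) ∈ clusterRegion H A i → AgreeAt p (R.upd ω) (ofSlabs p (a ω)) k f :=
    fun hω k hk f hf => R.agreeAt_mask (hω f) ⟨hk, hf⟩
  have hagreeB : ∀ {ω}, (∀ e, GoodPath (1 - p) (R.path e ω)) → ∀ k < m, ∀ f,
      (f, k) ∉ clusterRegion H A i → AgreeAt p (R.upd ω) (ofSlabs p (b ω)) k f :=
    fun hω k hk f hf => R.agreeAt_mask (hω f) ⟨hk, hf⟩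
  refine indepFun_cond_of_indepFun ha (hX₀.prodMk hb) hab
    (SA := {z | HasHistory p q (ofSlabs p z) m H A})
    (SB := {x | HasHistory p q (ofSlabs p x.2) m H Aᶜ})
    (measurableSet_historyDiagram_ofSlabs m H A)
    (measurable_snd (measurableSet_historyDiagram_ofSlabs m H Aᶜ))
    -- Since 𝓗_A(τ_i) = ∅, no state is carried over: the dynamics starts from ∅ with the updates in
    -- I₀ only.
    (F := fun z => fkState p q (ofSlabs p (mask I₀ z)) ∅ (tau p (i + 1)) ∩ H.atSet A (i + 1))
    (Ψ := fun x s => fkState p q (ofSlabs p x.2) x.1 s) ?_ ?_ ?_ ?_ ?_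
  · filter_upwards [hgood] with ω hω
    rw [historyDiagram_eq_iff A]
    refine and_congr ⟨?_, ?_⟩ ⟨?_, ?_⟩
    · exact HasHistory.congr_of_region hp₀ hp₁ hq hi him hAi (hagreeA hω)
    · exact HasHistory.congr_of_region hp₀ hp₁ hq hi him hAi
        fun k hk f hf => (hagreeA hω k hk f hf).symm
    · exact HasHistory.congr_of_compl_region hp₀ hp₁ hq hi hA (hagreeB hω)
    · exact HasHistory.congr_of_compl_region hp₀ hp₁ hq hi hA
        fun k hk f hf => (hagreeB hω k hk f hf).symm
  · exact (Measurable.of_discrete (f := fun s : Set G.edgeSet => s ∩ H.atSet A (i + 1))).comp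
      ((measurable_fkState_ofSlabs (p := p) (q := q) ∅ _).comp (measurable_mask I₀))
  · refine measurable_pi_lambda _ fun s => ?_
    exact measurable_from_prod_countable_right
      (f := fun x : Set G.edgeSet × (G.edgeSet × ℕ → ℕ → ℝ × ℝ) =>
        fkState p q (ofSlabs p x.2) x.1 s) fun x => measurable_fkState_ofSlabs x s
  · filter_upwards [hgood] with ω hω hH
    rw [(R.regular_upd hω).fkState_inter_atSet hp₀ hp₁ hq hi him hH A, hAi, Set.inter_empty]
    congr 1
    refine fkState_congr_of_agreeAt (i := i + 1) (fun k hk e => ?_) le_rfl _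
    by_cases hke : (e, k) ∈ I₀
    · obtain ⟨hki, hmid⟩ := hke
      simp only at hki hmid
      subst hki
      have h1 : AgreeAt p (R.upd ω) (ofSlabs p (a ω)) k e :=
        hagreeA hω k him e ⟨le_rfl, hmid⟩
      have h2 : AgreeAt p (ofSlabs p (a ω)) (ofSlabs p (mask I₀ (a ω))) k e :=
        agreeAt_ofSlabs (mask_of_mem (I := I₀) ⟨rfl, hmid⟩).symm
      refine Eq.trans ?_ (h1.trans h2)
      ext x
      exact ⟨fun h => ⟨h.1.2.1, h.2⟩, fun h => ⟨⟨hmid, h⟩, h.2⟩⟩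
    -- Off I₀ neither realization has updates: the recorded ones are on 𝓗_A(τ_{i+1/2}) and later
    -- than τ_i.
    · refine Eq.trans ?_ (updIn_ofSlabs_mask_of_notMem hke).symm
      refine Set.eq_empty_iff_forall_notMem.2 ?_
      rintro x ⟨⟨hmid, -, h1, h2⟩, h3, h4⟩
      simp only at hmid h1 h2
      rcases (Nat.lt_succ_iff.1 hk).eq_or_lt with rfl | hlt
      · exact hke ⟨rfl, hmid⟩
      · exact (h1.trans_le h4).not_ge (tau_mono p hlt)
  · filter_upwards [hgood] with ω hω _
    funext s
    refine fkState_congr_of_agreeAt (i := i) (fun k hk e => ?_) s.2.2 _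
    -- The region of A contains no slab k < i, so b retains all the updates up to τ_i.
    exact hagreeB hω k (by omega) e fun h => (h.1.trans_lt hk).false

end Random

end FK

/-! ### The theorem -/

theorem theorem4p5 (d n : ℕ) (hd : 2 ≤ d) [NeZero n] (p q : ℝ) (hp₀ : 0 < p) (hp₁ : p < 1)
    (hq : 1 < q) (m i : ℕ) (hi : 1 ≤ i) (him : i + 1 ≤ m)
    (H : FK.HistoryDiagram (FK.torus d n).edgeSet) (A : Set (FK.torus d n).edgeSet)
    (hA : H.IsCluster A) :
    ∃ F : Set (FK.torus d n).edgeSet → Set ((FK.torus d n).edgeSet × ℝ × ℝ) →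
        Set (FK.torus d n).edgeSet,
      ∀ {Ω : Type*} [MeasurableSpace Ω] (μ : Measure Ω) [IsProbabilityMeasure μ]
        (R : FK.RandomUpdates (FK.torus d n).edgeSet μ),
        (∀ᵐ ω ∂μ, FK.historyDiagram p q (R.upd ω) m = H → ∀ x₀ : Set (FK.torus d n).edgeSet,
          FK.fkState p q (R.upd ω) x₀ (FK.tau p (i + 1)) ∩ H.atSet A (i + 1) =
            F (FK.fkState p q (R.upd ω) x₀ (FK.tau p i) ∩ H.atSet A i)
              (FK.updOn (R.upd ω) (FK.tau p i) (FK.tau p (i + 1)) (H.midSet A i))) ∧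
        (H.atSet A i = ∅ →
          ∀ X₀ : Ω → Set (FK.torus d n).edgeSet, Measurable X₀ → R.IndepOf X₀ →
            IndepFun
              (fun ω => FK.fkState p q (R.upd ω) (X₀ ω) (FK.tau p (i + 1)) ∩ H.atSet A (i + 1))
              (fun ω (s : Set.Icc (0 : ℝ) (FK.tau p i)) =>
                FK.fkState p q (R.upd ω) (X₀ ω) s)
              (ProbabilityTheory.cond μ {ω | FK.historyDiagram p q (R.upd ω) m = H})) := by
  -- The function reruns the dynamics from Y with the updates u alone. For the u in question all of
  -- them lie in (τ_i, τ_{i+1}], so starting at time 0 amounts to starting at τ_i.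
  refine ⟨fun Y u => FK.fkState p q (FK.updOf u) Y (FK.tau p (i + 1)) ∩ H.atSet A (i + 1), ?_⟩
  intro Ω _ μ _ R
  refine ⟨?_, fun hAi X₀ hX₀ hind => R.indepFun_cond hp₀ hp₁ hq hi him hA hAi hX₀ hind⟩
  filter_upwards [R.ae_goodPath_path (1 - p)] with ω hω hH x₀
  exact (R.regular_upd hω).fkState_inter_atSet hp₀ hp₁ hq hi him hH A x₀
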